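/- Assume the Riemann Hypothesis. Let $0<t_1\le t_2\le\cdots$ be the ordinates of the non-trivial zeros of the Riemann zeta function $\zeta$ in the upper half-plane, listed in nondecreasing order and repeated according to multiplicity; that is, $t_n$ is the least $T$ for which $\zeta$ has at least $n$ zeros $\rho$, counted with multiplicity, with $0<\operatorname{Re}\rho<1$ and $0<\operatorname{Im}\rho\le T$ (there are infinitely many such zeros, so every $t_n$ with $n\ge 1$ exists and is positive). For integers $m\ge 1$ put $$Z(2m)=\frac{(-1)^{m+1}}{2}\left(\frac{1}{(2m-1)!}\,(\log|\zeta|)^{(2m)}\!\left(\tfrac12\right)+\sum_{k=1}^{\infty}\frac{1}{\left(\frac12+2k\right)^{2m}}-2^{2m}\right),$$ where $(\log|\zeta|)^{(2m)}(\frac12)$ is the $2m$-th derivative at $x=\frac12$ of the real function $x\mapsto\log|\zeta(x)|$, which is smooth near $\frac12$. This expression does not refer to the zeros of $\zeta$. Then $$Z(2m)=\sum_{k=1}^{\infty}\frac{1}{t_k^{2m}}\qquad\text{for every integer } m\ge 1,$$ and for every integer $n\ge 0$ $$t_{n+1}=\lim_{m\to\infty}\left[Z(2m)-\sum_{k=1}^{n}\frac{1}{t_k^{2m}}\right]^{-\frac{1}{2m}},$$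 where $m$ runs through the positive integers. In particular (the case $n=0$), $t_1=\lim_{m\to\infty}Z(2m)^{-1/(2m)}$. -/

import Mathlib

open Filter Topology
open scoped Nat ContDiff

/-- The non-trivial zeros `ρ` of the Riemann zeta function (those in the critical strip
`0 < Re ρ < 1`) whose ordinate satisfies `0 < Im ρ ≤ T`. -/
def nontrivialZerosUpTo (T : ℝ) : Set ℂ :=
  {ρ : ℂ | riemannZeta ρ = 0 ∧ 0 < ρ.re ∧ ρ.re < 1 ∧ 0 < ρ.im ∧ ρ.im ≤ T}

/-- There are only finitely many such zeros, so the counting function below is a finite sum. -/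
theorem nontrivialZerosUpTo_finite (T : ℝ) : (nontrivialZerosUpTo T).Finite := by
  have hK : IsCompact (Set.Icc (0 : ℝ) 1 ×ℂ Set.Icc (0 : ℝ) T) := isCompact_Icc.reProdIm isCompact_Icc
  refine hK.inter_riemannZetaZeros_finite.subset ?_
  rintro ρ ⟨h0, h1, h2, h3, h4⟩
  refine ⟨?_, h0⟩
  rw [Complex.mem_reProdIm]
  exact ⟨⟨h1.le, h2.le⟩, ⟨h3.le, h4⟩⟩

/-- The Riemann zero-counting function `N(T)`: the number of non-trivial zeros with
`0 < Im ρ ≤ T`, counted with multiplicity. -/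
noncomputable def zeroCount (T : ℝ) : ℕ :=
  ∑ ρ ∈ (nontrivialZerosUpTo_finite T).toFinset, analyticOrderNatAt riemannZeta ρ

/-- The `n`-th ordinate `t_n` (`n ≥ 1`) of the non-trivial zeros in the upper half-plane, in
nondecreasing order and repeated according to multiplicity: the least `T` with `N(T) ≥ n`.
The value at `n = 0` is never used. -/
noncomputable def zeroOrdinate (n : ℕ) : ℝ :=
  sInf {T : ℝ | n ≤ zeroCount T}

/-- The function `log |ζ|` on the real line. -/
noncomputable def logAbsZeta (x : ℝ) : ℝ :=
  Real.log ‖riemannZeta (x : ℂ)‖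

/-- The expression
`((-1)^(m+1) / 2) * ((log|ζ|)^{(2m)}(1/2) / (2m-1)! + ∑_{k ≥ 1} (1/2 + 2k)^{-2m} - 2^{2m})`,
for `m ≥ 1`; it does not involve the zeros of `ζ`. -/
noncomputable def vorosZ (m : ℕ) : ℝ :=
  (-1) ^ (m + 1) / 2 *
    (iteratedDeriv (2 * m) logAbsZeta (1 / 2) / ((2 * m - 1)! : ℝ)
      + ∑' k : ℕ, 1 / (1 / 2 + 2 * ((k : ℝ) + 1)) ^ (2 * m)
      - 2 ^ (2 * m))

/-- The series in `vorosZ` converges for every `m ≥ 1`. -/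
theorem summable_vorosZ_series (m : ℕ) (hm : 1 ≤ m) :
    Summable fun k : ℕ => 1 / (1 / 2 + 2 * ((k : ℝ) + 1)) ^ (2 * m) := by
  have h : Summable fun k : ℕ => 1 / ((k + 1 : ℕ) : ℝ) ^ (2 * m) :=
    (summable_nat_add_iff 1).2 (Real.summable_one_div_nat_pow.2 (by omega))
  refine Summable.of_nonneg_of_le (fun k => by positivity) (fun k => ?_) h
  have hk : (0 : ℝ) ≤ k := k.cast_nonneg
  refine one_div_le_one_div_of_le (by positivity) (pow_le_pow_left₀ (by positivity) ?_ _)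
  push_cast
  linarith

/-! Let F = `centredXi`, that is F(z) = s(s - 1)Λ(s) with s = 1/2 + z. It is entire and even, and
under RH its zeros are ±i t_k. The power sums of these zeros are Taylor coefficients of F'/F at 0,
while the factorisation of F through Γ and ζ expresses the same coefficients by derivatives of
log|ζ| at 1/2, a pole term 2^(2m), and a sum over the trivial zeros.

The first fact is proved without an infinite product. Divide F by its zeros in |z| ≤ R. The cofactor
G has no zeros in the disc, and the maximum principle bounds |G| by e^M |G(0)| there, with M taken
from the growth of F on |z| = 2R. Borel-Carathéodory and Cauchy then bound the j-th derivative of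
G'/G at 0 by a constant times M / R^(j+1) (`norm_iteratedDeriv_logDeriv_add_sum_le`). If M = o(R²),
this vanishes in the limit for every j ≥ 1. The same estimate, applied to shifted Gamma functions,
gives the polygamma series (`tendsto_sum_polygamma`).

The growth of F comes from Λ₀ being the Mellin transform of a nonnegative kernel: |Λ₀(s)| is at most
its value at Re s, which is convex and symmetric about 1/2, hence controlled by values at even
integers (`exists_centredXi_growth`). The same explicit values grow factorially, so F cannot be a
polynomial times an exponential and has infinitely many zeros (`infinite_centredXi_zeros`); hence
all ordinates exist.

Finally, after removal of n terms the power sum lies between t^(-2m) and a constant times t^(-2m),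
where t = t_(n+1). The root of order 2m removes the constant (`tendsto_tail_rpow`). -/

/-! ### Logarithmic derivatives of entire functions and their zeros in discs -/

open Metric Set in
/-- Cauchy estimates for the logarithm of a zero-free function on a disc whose size is controlled
relative to its value at the centre. -/
theorem norm_iteratedDeriv_logDeriv_le {G : ℂ → ℂ} {R M : ℝ} (hR : 0 < R) (hM : 0 < M)
    (hd : DifferentiableOn ℂ G (ball 0 R)) (h0 : ∀ z ∈ ball (0 : ℂ) R, G z ≠ 0)
    (hG : ∀ z ∈ ball (0 : ℂ) R, ‖G z‖ ≤ Real.exp M * ‖G 0‖) (j : ℕ) :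
    ‖iteratedDeriv j (logDeriv G) 0‖ ≤ (j + 1)! * (2 * M) / (R / 2) ^ (j + 1) := by
  have hmem : (0 : ℂ) ∈ ball (0 : ℂ) R := mem_ball_self hR
  have hld : DifferentiableOn ℂ (logDeriv G) (ball 0 R) :=
    (hd.deriv isOpen_ball).div hd h0
  -- `L` is the branch of log(G / G 0) vanishing at 0, built as a primitive of the logarithmic
  -- derivative.
  obtain ⟨L, hL0, hL⟩ := hld.isExactOn_ball.with_val_at 0 0
  have hLd : DifferentiableOn ℂ L (ball 0 R) :=
    fun z hz => (hL z hz).differentiableAt.differentiableWithinAt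
  have hGd : ∀ z ∈ ball (0 : ℂ) R, HasDerivAt G (deriv G z) z := fun z hz =>
    (hd.differentiableAt (isOpen_ball.mem_nhds hz)).hasDerivAt
  have key : ∀ z ∈ ball (0 : ℂ) R, G z * Complex.exp (-L z) = G 0 := by
    have hder : ∀ z ∈ ball (0 : ℂ) R,
        HasDerivAt (fun z => G z * Complex.exp (-L z)) 0 z := by
      intro z hz
      have hz0 := h0 z hz
      refine ((hGd z hz).mul ((hL z hz).neg.cexp)).congr_deriv ?_
      simp only [logDeriv_apply, Pi.neg_apply]
      field_simp
      ring
    intro z hz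
    have := isOpen_ball.is_const_of_deriv_eq_zero (convex_ball (0 : ℂ) R).isPreconnected
      (f := fun z => G z * Complex.exp (-L z))
      (fun z hz => (hder z hz).differentiableAt.differentiableWithinAt)
      (fun z hz => (hder z hz).deriv) hz hmem
    simpa [hL0] using this
  have hre : MapsTo L (ball 0 R) {z | z.re ≤ M} := by
    intro z hz
    have h1 := congrArg norm (key z hz)
    rw [norm_mul, Complex.norm_exp, Complex.neg_re] at h1
    have h2 := hG z hz
    have h3 : 0 < ‖G z‖ := norm_pos_iff.2 (h0 z hz)
    rw [← h1, mul_left_comm, ← Real.exp_add] at h2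
    have h4 : 1 ≤ Real.exp (M + -(L z).re) := by
      by_contra hlt
      push Not at hlt
      nlinarith
    rw [Real.one_le_exp_iff] at h4
    simp only [mem_ofPred_eq]
    linarith
  have hbd : ∀ z ∈ sphere (0 : ℂ) (R / 2), ‖L z‖ ≤ 2 * M := by
    intro z hz
    have hz' : ‖z‖ = R / 2 := by simpa using hz
    -- At radius r = R/2 the Borel-Carathéodory factor 2Mr/(R - r) is exactly 2M.
    have := Complex.borelCaratheodory_zero hM hLd hre hR (z := z) (by simp [hz', hR]) hL0
    rw [hz'] at this
    refine this.trans_eq ?_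
    field_simp
    ring
  have hcl : DiffContOnCl ℂ L (ball 0 (R / 2)) := by
    refine (hLd.mono ?_).diffContOnCl
    rw [closure_ball _ (by positivity)]
    exact closedBall_subset_ball (by linarith)
  have := Complex.norm_iteratedDeriv_le_of_forall_mem_sphere_norm_le (j + 1) (by positivity) hcl hbd
  rw [iteratedDeriv_succ'] at this
  have heq : deriv L =ᶠ[𝓝 0] logDeriv G := by
    filter_upwards [isOpen_ball.mem_nhds hmem] with z hz using (hL z hz).deriv
  rwa [heq.iteratedDeriv_eq] at this

/-- An entire function of finite order of vanishing at a point splits off the corresponding power,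
with an entire cofactor. -/
theorem exists_entire_eq_pow_mul {F : ℂ → ℂ} (hF : Differentiable ℂ F) (w : ℂ)
    (hw : analyticOrderAt F w ≠ ⊤) :
    ∃ G : ℂ → ℂ, Differentiable ℂ G ∧ G w ≠ 0 ∧
      ∀ z, F z = (z - w) ^ analyticOrderNatAt F w * G z := by
  obtain ⟨g, hg, hgw, hFg⟩ := ((hF.analyticAt w).analyticOrderAt_eq_natCast).1
    (Nat.cast_analyticOrderNatAt hw).symm
  set n := analyticOrderNatAt F w
  have hne : ∀ z, z ≠ w → z - w ≠ 0 := fun z => sub_ne_zero.2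
  -- The quotient has a removable singularity at `w`; the local factor `g` supplies the missing
  -- value.
  refine ⟨Function.update (fun z => F z / (z - w) ^ n) w (g w), fun z => ?_, by simpa, fun z => ?_⟩
  · rcases eq_or_ne z w with rfl | hz
    · refine hg.differentiableAt.congr_of_eventuallyEq ?_
      filter_upwards [hFg] with y hy
      rcases eq_or_ne y z with rfl | hyz
      · simp
      · rw [Function.update_of_ne hyz, hy, smul_eq_mul,
          mul_div_cancel_left₀ _ (pow_ne_zero _ (hne y hyz))]
    · have : DifferentiableAt ℂ (fun z => F z / (z - w) ^ n) z :=
        (hF z).div (by fun_prop) (pow_ne_zero _ (hne z hz))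
      refine this.congr_of_eventuallyEq ?_
      filter_upwards [isOpen_ne.mem_nhds hz] with y hy
      rw [Function.update_of_ne hy]
  · rcases eq_or_ne z w with rfl | hz
    · simpa using hFg.self_of_nhds
    · rw [Function.update_of_ne hz, mul_div_cancel₀ _ (pow_ne_zero _ (hne z hz))]

/-- An entire function splits off its zeros at finitely many points, with an entire cofactor. -/
theorem exists_entire_eq_prod_mul {F : ℂ → ℂ} (hF : Differentiable ℂ F)
    (ht : ∀ w, analyticOrderAt F w ≠ ⊤) (S : Finset ℂ) :
    ∃ G : ℂ → ℂ, Differentiable ℂ G ∧ (∀ w ∈ S, G w ≠ 0) ∧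
      ∀ z, F z = (∏ w ∈ S, (z - w) ^ analyticOrderNatAt F w) * G z := by
  induction S using Finset.induction_on with
  | empty => exact ⟨F, hF, by simp, by simp⟩
  | insert w S hwS ih =>
    obtain ⟨G, hG, hG0, hFG⟩ := ih
    set P : ℂ → ℂ := fun z => ∏ w ∈ S, (z - w) ^ analyticOrderNatAt F w with hP
    have hPd : Differentiable ℂ P := by
      rw [hP]
      fun_prop
    have hPw : P w ≠ 0 := by
      refine Finset.prod_ne_zero_iff.2 fun v hv => pow_ne_zero _ (sub_ne_zero.2 ?_)
      rintro rfl
      exact hwS hv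
    have hFeq : F = P * G := funext hFG
    have hord : analyticOrderAt F w = analyticOrderAt G w := by
      conv_lhs => rw [hFeq]
      rw [analyticOrderAt_mul (hPd.analyticAt w) (hG.analyticAt w),
        (hPd.analyticAt w).analyticOrderAt_eq_zero.2 hPw, zero_add]
    obtain ⟨H, hH, hHw, hGH⟩ := exists_entire_eq_pow_mul hG w (hord ▸ ht w)
    have hordN : analyticOrderNatAt G w = analyticOrderNatAt F w := by
      simp [analyticOrderNatAt, hord]
    refine ⟨H, hH, ?_, fun z => ?_⟩
    · intro v hv
      rcases Finset.mem_insert.1 hv with rfl | hv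
      · exact hHw
      · have := hG0 v hv
        rw [hGH] at this
        exact right_ne_zero_of_mul this
    · rw [Finset.prod_insert hwS, hFG, hGH, hordN]
      ring

theorem iteratedDeriv_inv_sub_const (j : ℕ) (w : ℂ) :
    iteratedDeriv j (fun z : ℂ => (z - w)⁻¹) 0 = -(j ! : ℂ) / w ^ (j + 1) := by
  have h := iteratedDeriv_comp_sub_const (𝕜 := ℂ) j (fun z => z⁻¹) w
  rw [h, iteratedDeriv_eq_iterate]
  simp only [zero_sub, iter_deriv_inv']
  have : (-1 - (j : ℤ)) = -((j + 1 : ℕ) : ℤ) := by push_cast; ring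
  rw [this, zpow_neg, zpow_natCast, neg_pow w, mul_inv, pow_succ]
  have : ((-1 : ℂ) ^ j) * ((-1) ^ j) = 1 := by rw [← mul_pow]; simp
  have h1 : ((-1 : ℂ) ^ j) ≠ 0 := by simp
  field_simp

open Metric Set in
/-- Removing zeros in the disc of radius `R` does not increase the size relative to the centre. -/
theorem norm_cofactor_le {F G : ℂ → ℂ} (hG : Differentiable ℂ G) {S : Finset ℂ} {k : ℂ → ℕ}
    (hFG : ∀ z, F z = (∏ w ∈ S, (z - w) ^ k w) * G z) (hF0 : F 0 ≠ 0) {R M : ℝ} (hR : 0 < R)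
    (hS : ∀ w ∈ S, ‖w‖ ≤ R) (hbd : ∀ z, ‖z‖ = 2 * R → ‖F z‖ ≤ Real.exp M * ‖F 0‖) :
    ∀ z ∈ ball (0 : ℂ) R, ‖G z‖ ≤ Real.exp M * ‖G 0‖ := by
  set P : ℂ → ℂ := fun z => ∏ w ∈ S, (z - w) ^ k w with hP
  have hP0 : P 0 ≠ 0 := fun h => hF0 (by rw [hFG]; exact mul_eq_zero_of_left h _)
  have hsph : ∀ z, ‖z‖ = 2 * R → ‖G z‖ ≤ Real.exp M * ‖G 0‖ := by
    intro z hz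
    -- On |z| = 2R each factor satisfies |z - w| ≥ 2R - |w| ≥ R ≥ |w|, which is why F is bounded on
    -- the circle of twice the radius.
    have hPz : ‖P 0‖ ≤ ‖P z‖ := by
      simp only [hP, norm_prod, norm_pow]
      refine Finset.prod_le_prod (fun _ _ => by positivity) fun w hw => ?_
      have hwR := hS w hw
      gcongr
      have := norm_sub_norm_le z w
      simp only [zero_sub, norm_neg]
      linarith
    have h1 := hbd z hz
    rw [hFG z, hFG 0, norm_mul, norm_mul] at h1
    refine le_of_mul_le_mul_left ?_ (norm_pos_iff.2 hP0)
    calc ‖P 0‖ * ‖G z‖ ≤ ‖P z‖ * ‖G z‖ := by gcongr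
      _ ≤ Real.exp M * (‖P 0‖ * ‖G 0‖) := h1
      _ = ‖P 0‖ * (Real.exp M * ‖G 0‖) := by ring
  intro z hz
  refine Complex.norm_le_of_forall_mem_frontier_norm_le (U := ball (0 : ℂ) (2 * R))
    isBounded_ball hG.diffContOnCl ?_ (subset_closure ?_)
  · intro y hy
    rw [frontier_ball _ (by positivity)] at hy
    exact hsph y (by simpa using hy)
  · exact ball_subset_ball (by linarith) hz

open Metric Set in
/-- Comparison of the Taylor coefficients of the logarithmic derivative of an entire function with
the power sums over its zeros in a disc. -/
theorem norm_iteratedDeriv_logDeriv_add_sum_le {F : ℂ → ℂ} (hF : Differentiable ℂ F)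
    (hF0 : F 0 ≠ 0) {R M : ℝ} (hR : 0 < R) (hM : 0 < M)
    (hbd : ∀ z, ‖z‖ = 2 * R → ‖F z‖ ≤ Real.exp M * ‖F 0‖)
    {S : Finset ℂ} (hS : ∀ z, z ∈ S ↔ F z = 0 ∧ ‖z‖ ≤ R) (j : ℕ) :
    ‖iteratedDeriv j (logDeriv F) 0
      + j ! * ∑ w ∈ S, (analyticOrderNatAt F w : ℂ) / w ^ (j + 1)‖
      ≤ (j + 1)! * (2 * M) / (R / 2) ^ (j + 1) := by
  have ht : ∀ w, analyticOrderAt F w ≠ ⊤ := by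
    intro w hw
    have := (AnalyticOnNhd.analyticOrderAt_eq_top_iff_eq_zero w
      (fun z => hF.analyticAt z)).1 hw
    exact hF0 (by simp [this])
  obtain ⟨G, hG, hGS, hFG⟩ := exists_entire_eq_prod_mul hF ht S
  set P : ℂ → ℂ := fun z => ∏ w ∈ S, (z - w) ^ analyticOrderNatAt F w with hP
  have hPd : Differentiable ℂ P := by
    rw [hP]
    fun_prop
  have hP0 : P 0 ≠ 0 := fun h => hF0 (by rw [hFG]; exact mul_eq_zero_of_left h _)
  have hG0 : G 0 ≠ 0 := fun h => hF0 (by rw [hFG, h, mul_zero])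
  have hGne : ∀ z ∈ ball (0 : ℂ) R, G z ≠ 0 := by
    intro z hz hGz
    have hzS : z ∈ S := (hS z).2 ⟨by rw [hFG, hGz, mul_zero], (mem_ball_zero_iff.1 hz).le⟩
    exact hGS z hzS hGz
  have hball := norm_cofactor_le hG hFG hF0 hR (fun w hw => ((hS w).1 hw).2) hbd
  have hA := norm_iteratedDeriv_logDeriv_le hR hM hG.differentiableOn hGne hball j
  have hev : logDeriv G =ᶠ[𝓝 0] fun z => logDeriv F z
      - ∑ w ∈ S, (analyticOrderNatAt F w : ℂ) * (z - w)⁻¹ := by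
    filter_upwards [hPd.continuous.continuousAt.eventually_ne hP0,
      hG.continuous.continuousAt.eventually_ne hG0] with z hPz hGz
    have h1 : logDeriv F z = logDeriv P z + logDeriv G z := by
      rw [← logDeriv_mul z hPz hGz (hPd z) (hG z)]
      congr 1
      exact funext hFG
    have h2 : logDeriv P z = ∑ w ∈ S, (analyticOrderNatAt F w : ℂ) * (z - w)⁻¹ := by
      have hne := Finset.prod_ne_zero_iff.1 hPz
      rw [hP, logDeriv_prod (f := fun w z => (z - w) ^ analyticOrderNatAt F w) hne
        (fun w _ => by fun_prop)]
      refine Finset.sum_congr rfl fun w hw => ?_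
      rw [logDeriv_fun_pow (by fun_prop), logDeriv_apply]
      simp
    rw [h1, h2]
    ring
  have hwne : ∀ w ∈ S, w ≠ 0 := by
    rintro w hw rfl
    exact hF0 ((hS 0).1 hw).1
  have hcd : ∀ w ∈ S, ContDiffAt ℂ j
      (fun z : ℂ => (analyticOrderNatAt F w : ℂ) * (z - w)⁻¹) 0 := fun w hw =>
    contDiffAt_const.mul ((contDiffAt_id.sub contDiffAt_const).inv (by simpa using hwne w hw))
  have hcF : ContDiffAt ℂ j (logDeriv F) 0 :=
    ((hF.analyticAt 0).deriv.div (hF.analyticAt 0) hF0).contDiffAt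
  rw [hev.iteratedDeriv_eq, iteratedDeriv_fun_sub hcF (ContDiffAt.sum hcd),
    iteratedDeriv_fun_sum hcd] at hA
  convert hA using 2
  rw [sub_eq_add_neg, Finset.mul_sum, ← Finset.sum_neg_distrib]
  congr 1
  refine Finset.sum_congr rfl fun w hw => ?_
  rw [iteratedDeriv_const_mul_field, iteratedDeriv_inv_sub_const]
  ring

/-- A zero-free entire function whose logarithm grows slower than quadratically along a sequence of
discs is the exponential of a polynomial of degree at most one. -/
theorem eq_mul_exp_of_growth {G : ℂ → ℂ} (hG : Differentiable ℂ G) (h0 : ∀ z, G z ≠ 0) {M : ℕ → ℝ}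
    (hb : ∀ j : ℕ, 1 ≤ j → Tendsto
      (fun n : ℕ => ((j + 1)! : ℝ) * (2 * M n) / ((n : ℝ) / 2) ^ (j + 1)) atTop (𝓝 0))
    (hM : ∀ᶠ n : ℕ in atTop, 0 < M n ∧
      ∀ z ∈ Metric.ball (0 : ℂ) n, ‖G z‖ ≤ Real.exp (M n) * ‖G 0‖) :
    ∃ c : ℂ, ∀ z, G z = G 0 * Complex.exp (c * z) := by
  -- The Cauchy bound holds on arbitrarily large discs and tends to 0, so only the constant Taylor
  -- coefficient of G'/G survives.
  have hzero : ∀ j : ℕ, 1 ≤ j → iteratedDeriv j (logDeriv G) 0 = 0 := by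
    intro j hj
    refine norm_le_zero_iff.1 (ge_of_tendsto (hb j hj) ?_)
    filter_upwards [hM, eventually_gt_atTop 0] with n hn hn0
    exact norm_iteratedDeriv_logDeriv_le (by exact_mod_cast hn0) hn.1 hG.differentiableOn
      (fun z _ => h0 z) hn.2 j
  have hld : Differentiable ℂ (logDeriv G) := fun z =>
    ((hG.analyticAt z).deriv.div (hG.analyticAt z) (h0 z)).differentiableAt
  have hconst : ∀ z, logDeriv G z = logDeriv G 0 := by
    intro z
    rw [← Complex.taylorSeries_eq_of_entire' 0 z hld, tsum_eq_single 0]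
    · simp
    · intro n hn
      rw [hzero n (Nat.one_le_iff_ne_zero.2 hn)]
      simp
  refine ⟨logDeriv G 0, fun z => ?_⟩
  have hder : ∀ z, HasDerivAt (fun z => G z * Complex.exp (-(logDeriv G 0 * z))) 0 z := by
    intro z
    have h1 : HasDerivAt (fun z => -(logDeriv G 0 * z)) (-(logDeriv G 0)) z := by
      simpa using ((hasDerivAt_id z).const_mul (logDeriv G 0)).fun_neg
    refine ((hG z).hasDerivAt.mul h1.cexp).congr_deriv ?_
    rw [← hconst z, logDeriv_apply]
    have := h0 z
    field_simp
    ring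
  have := is_const_of_deriv_eq_zero (fun z => (hder z).differentiableAt) (fun z => (hder z).deriv) z 0
  simp only [mul_zero, neg_zero, Complex.exp_zero, mul_one] at this
  rw [← this, mul_assoc, ← Complex.exp_add]
  simp

/-! ### Gamma function bounds and the polygamma series -/

/-- The Gamma function is bounded on vertical lines by its value on the real axis. -/
theorem norm_Gamma_le_Gamma_re {s : ℂ} (hs : 0 < s.re) : ‖Complex.Gamma s‖ ≤ Real.Gamma s.re := by
  rw [Complex.Gamma_eq_integral hs, Real.Gamma_eq_integral hs, Complex.GammaIntegral]
  refine (MeasureTheory.norm_integral_le_integral_norm _).trans_eq ?_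
  refine MeasureTheory.setIntegral_congr_fun measurableSet_Ioi fun x hx => ?_
  simp only [norm_mul, Complex.norm_real, Real.norm_eq_abs, Real.abs_exp]
  rw [Complex.norm_cpow_eq_rpow_re_of_pos hx]
  simp

/-- A crude bound suffices: the factor (x + k)^k costs only k log(x + k) = o(k²) in the exponent. -/
theorem Gamma_add_nat_le {x : ℝ} (hx : 0 < x) (k : ℕ) :
    Real.Gamma (x + k) ≤ (x + k) ^ k * Real.Gamma x := by
  induction k with
  | zero => simp
  | succ k ih =>
    have hΓ := Real.Gamma_pos_of_pos hx
    have h1 : x + (k + 1 : ℕ) = (x + k) + 1 := by push_cast; ring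
    rw [h1, Real.Gamma_add_one (by positivity), pow_succ]
    calc (x + k) * Real.Gamma (x + k) ≤ (x + k) * ((x + k) ^ k * Real.Gamma x) := by gcongr
      _ ≤ (x + k + 1) * ((x + k + 1) ^ k * Real.Gamma x) := by
          have hle : x + k ≤ x + k + 1 := by linarith
          have hy : 0 ≤ x + k + 1 := by positivity
          generalize x + k + 1 = y at hle hy
          gcongr
      _ = _ := by ring

/-- The denominator has degree j + 1 ≥ 2, so growth exponents of size o(n²) are negligible for every
coefficient except j = 0. -/
theorem tendsto_cauchy_bound {M : ℕ → ℝ} (hM0 : ∀ n, 0 ≤ M n)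
    (hM : Tendsto (fun n : ℕ => M n / (n : ℝ) ^ 2) atTop (𝓝 0)) {j : ℕ} (hj : 1 ≤ j) :
    Tendsto (fun n : ℕ => ((j + 1)! : ℝ) * (2 * M n) / ((n : ℝ) / 2) ^ (j + 1)) atTop (𝓝 0) := by
  have h := hM.const_mul (((j + 1)! : ℝ) * 2 * 2 ^ (j + 1))
  rw [mul_zero] at h
  refine squeeze_zero' (Eventually.of_forall fun n => ?_) ?_ h
  · have := hM0 n
    positivity
  · filter_upwards [eventually_ge_atTop 1] with n hn
    have hn' : (1 : ℝ) ≤ n := by exact_mod_cast hn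
    have hMn := hM0 n
    have hp : (n : ℝ) ^ 2 ≤ (n : ℝ) ^ (j + 1) := pow_le_pow_right₀ hn' (by omega)
    rw [div_pow, div_div_eq_mul_div]
    calc ((j + 1)! : ℝ) * (2 * M n) * 2 ^ (j + 1) / (n : ℝ) ^ (j + 1)
        ≤ ((j + 1)! : ℝ) * (2 * M n) * 2 ^ (j + 1) / (n : ℝ) ^ 2 := by gcongr
      _ = _ := by ring

theorem tendsto_mul_log_div_sq (c d : ℝ) (hc : 1 ≤ c) (hd : 0 < d) :
    Tendsto (fun n : ℕ => ((n : ℝ) * Real.log (c + d * n)) / (n : ℝ) ^ 2) atTop (𝓝 0) := by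
  have h1 : Tendsto (fun n : ℕ => c + d * (n : ℝ)) atTop atTop :=
    tendsto_atTop_add_const_left _ _ (tendsto_natCast_atTop_atTop.const_mul_atTop hd)
  have h2 := (Real.isLittleO_log_id_atTop.tendsto_div_nhds_zero.comp h1).mul_const (c + d)
  rw [zero_mul] at h2
  refine squeeze_zero' ?_ ?_ h2
  · refine Eventually.of_forall fun n => ?_
    have : 0 ≤ Real.log (c + d * n) := Real.log_nonneg (by nlinarith [n.cast_nonneg (α := ℝ)])
    positivity
  · filter_upwards [eventually_ge_atTop 1] with n hn
    have hn' : (1 : ℝ) ≤ n := by exact_mod_cast hn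
    have hl : 0 ≤ Real.log (c + d * n) := Real.log_nonneg (by nlinarith)
    have hp : 0 < c + d * n := by nlinarith
    simp only [Function.comp_apply, id]
    rw [div_mul_eq_mul_div, div_le_div_iff₀ (by positivity) hp]
    nlinarith [mul_nonneg hl (by positivity : (0 : ℝ) ≤ n * (c * (n - 1) + 0)),
      mul_nonneg hl (mul_nonneg (by positivity : (0 : ℝ) ≤ n * c) (sub_nonneg.2 hn'))]

theorem differentiableAt_Gamma_comp {b : ℂ} {z : ℂ} (h : 0 < (b + z / 2).re) :
    DifferentiableAt ℂ (fun z : ℂ => Complex.Gamma (b + z / 2)) z := by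
  refine (Complex.differentiableAt_Gamma _ fun m hm => ?_).comp z (by fun_prop)
  rw [hm] at h
  simp only [Complex.neg_re, Complex.natCast_re] at h
  linarith [m.cast_nonneg (α := ℝ)]

theorem Gamma_add_nat_eq_prod {s : ℂ} (hs : 0 < s.re) (n : ℕ) :
    Complex.Gamma (s + n) = (∏ i ∈ Finset.range n, (s + i)) * Complex.Gamma s := by
  induction n with
  | zero => simp
  | succ n ih =>
    have hne : s + n ≠ 0 := fun h => by
      have := congrArg Complex.re h
      simp only [Complex.add_re, Complex.natCast_re, Complex.zero_re] at this
      linarith [n.cast_nonneg (α := ℝ)]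
    rw [Finset.prod_range_succ, Nat.cast_succ, ← add_assoc, Complex.Gamma_add_one _ hne, ih]
    ring

/-- The functional equation of Γ splits off its first n poles z = -(2a + 2i). What remains is
regular and zero-free on a disc of radius n, where the Cauchy estimate applies. -/
theorem iteratedDeriv_logDeriv_Gamma_add_nat {a : ℝ} (ha : 0 < a) (j n : ℕ) :
    iteratedDeriv j (logDeriv fun z : ℂ => Complex.Gamma ((a + n : ℝ) + z / 2)) 0 =
      iteratedDeriv j (logDeriv fun z : ℂ => Complex.Gamma (a + z / 2)) 0 +
        (-1) ^ j * j ! * ∑ i ∈ Finset.range n, 1 / (2 * (a : ℂ) + 2 * i) ^ (j + 1) := by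
  have hpos : ∀ᶠ z : ℂ in 𝓝 0, 0 < ((a : ℂ) + z / 2).re := by
    have : ContinuousAt (fun z : ℂ => ((a : ℂ) + z / 2).re) 0 := by fun_prop
    exact this.eventually_const_lt (by simpa using ha)
  have hfac : ∀ i : ℕ, ∀ z : ℂ, 0 < ((a : ℂ) + z / 2).re → (a : ℂ) + z / 2 + i ≠ 0 := by
    intro i z hz h
    have := congrArg Complex.re h
    rw [Complex.add_re, Complex.natCast_re, Complex.zero_re] at this
    linarith [i.cast_nonneg (α := ℝ)]
  have hw : ∀ i : ℕ, (-(2 * (a : ℂ) + 2 * i)) ≠ 0 := by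
    intro i h
    apply hfac i 0 (by simpa using ha)
    linear_combination (-1 / 2) * h
  have hev : (logDeriv fun z : ℂ => Complex.Gamma ((a + n : ℝ) + z / 2)) =ᶠ[𝓝 0]
      fun z => logDeriv (fun z : ℂ => Complex.Gamma (a + z / 2)) z +
        ∑ i ∈ Finset.range n, (z - (-(2 * (a : ℂ) + 2 * i)))⁻¹ := by
    filter_upwards [hpos.eventually_nhds] with z hz
    have hz0 := hz.self_of_nhds
    have h1 : (fun z : ℂ => Complex.Gamma ((a + n : ℝ) + z / 2)) =ᶠ[𝓝 z]
        fun z => (∏ i ∈ Finset.range n, ((a : ℂ) + z / 2 + i)) * Complex.Gamma (a + z / 2) := by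
      filter_upwards [hz] with y hy
      rw [← Gamma_add_nat_eq_prod hy]
      congr 1
      push_cast
      ring
    rw [(logDeriv_congr_nhds h1).self_of_nhds, logDeriv_mul (f := fun z =>
      ∏ i ∈ Finset.range n, ((a : ℂ) + z / 2 + i)) z
      (Finset.prod_ne_zero_iff.2 fun i _ => hfac i z hz0)
      (Complex.Gamma_ne_zero_of_re_pos (s := a + z / 2) hz0) (by fun_prop) (differentiableAt_Gamma_comp hz0),
      logDeriv_prod (f := fun (i : ℕ) z => (a : ℂ) + z / 2 + i) (fun i _ => hfac i z hz0)
      (fun i _ => by fun_prop), add_comm]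
    congr 1
    refine Finset.sum_congr rfl fun i _ => ?_
    have hd : HasDerivAt (fun z : ℂ => (a : ℂ) + z / 2 + i) (1 / 2) z :=
      (((hasDerivAt_id z).div_const 2).const_add _).add_const _
    rw [logDeriv_apply, hd.deriv, div_div, one_div]
    congr 1
    ring
  have han : AnalyticAt ℂ (fun z : ℂ => Complex.Gamma (a + z / 2)) 0 := by
    rw [Complex.analyticAt_iff_eventually_differentiableAt]
    filter_upwards [hpos] with z hz using differentiableAt_Gamma_comp hz
  have hcG : ContDiffAt ℂ j (logDeriv fun z : ℂ => Complex.Gamma (a + z / 2)) 0 :=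
    (han.deriv.div han (Complex.Gamma_ne_zero_of_re_pos (by simpa using ha))).contDiffAt
  have hcd : ∀ i ∈ Finset.range n, ContDiffAt ℂ j
      (fun z : ℂ => (z - (-(2 * (a : ℂ) + 2 * i)))⁻¹) 0 := fun i _ =>
    (contDiffAt_id.sub contDiffAt_const).inv (by rw [id, zero_sub]; exact neg_ne_zero.2 (hw i))
  rw [hev.iteratedDeriv_eq, iteratedDeriv_fun_add hcG (ContDiffAt.sum hcd),
    iteratedDeriv_fun_sum hcd, Finset.mul_sum]
  congr 1
  refine Finset.sum_congr rfl fun i _ => ?_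
  rw [iteratedDeriv_inv_sub_const, neg_pow, pow_succ (-1 : ℂ)]
  have h1 : ((-1 : ℂ) ^ j)⁻¹ = (-1) ^ j := by rw [← inv_pow]; norm_num
  simp only [div_eq_mul_inv, mul_inv, h1]
  ring

open Metric in
/-- The polygamma series: the Taylor coefficients of the logarithmic derivative of
`z ↦ Γ (a + z / 2)` at `0`. -/
theorem tendsto_sum_polygamma {a : ℝ} (ha : 1 ≤ a) {j : ℕ} (hj : 1 ≤ j) :
    Tendsto (fun n : ℕ => (-1) ^ j * j ! *
        ∑ i ∈ Finset.range n, 1 / (2 * (a : ℂ) + 2 * i) ^ (j + 1)) atTop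
      (𝓝 (-iteratedDeriv j (logDeriv fun z : ℂ => Complex.Gamma (a + z / 2)) 0)) := by
  have hlim := tendsto_mul_log_div_sq a 2 ha two_pos
  have hlog : ∀ n : ℕ, 0 ≤ Real.log (a + 2 * n) := fun n =>
    Real.log_nonneg (by linarith [n.cast_nonneg (α := ℝ)])
  have hb := tendsto_cauchy_bound (M := fun n : ℕ => (n : ℝ) * Real.log (a + 2 * n))
    (fun n => mul_nonneg n.cast_nonneg (hlog n)) hlim hj
  rw [tendsto_iff_norm_sub_tendsto_zero]
  refine squeeze_zero' (Eventually.of_forall fun _ => norm_nonneg _) ?_ hb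
  filter_upwards [eventually_ge_atTop 2] with n hn
  have hn' : (2 : ℝ) ≤ n := by exact_mod_cast hn
  rw [sub_neg_eq_add, add_comm, ← iteratedDeriv_logDeriv_Gamma_add_nat (by linarith)]
  -- The lower bound 2 places both real arguments in the range where the real Gamma function is
  -- increasing; it uses a ≥ 1 and n ≥ 2.
  have hre : ∀ z ∈ ball (0 : ℂ) n, 2 ≤ (((a + n : ℝ) : ℂ) + z / 2).re ∧
      (((a + n : ℝ) : ℂ) + z / 2).re ≤ a + n + n := by
    intro z hz
    have h1 : ‖z‖ < n := by simpa using hz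
    have h2 := abs_le.1 (Complex.abs_re_le_norm z)
    have h3 : (((a + n : ℝ) : ℂ) + z / 2).re = a + n + z.re / 2 := by simp
    rw [h3]
    constructor <;> linarith
  have hΓ : 0 < Real.Gamma (a + n) := Real.Gamma_pos_of_pos (by linarith)
  refine norm_iteratedDeriv_logDeriv_le (by linarith)
    (mul_pos (by linarith) (Real.log_pos (by linarith))) (fun z hz => ?_) (fun z hz => ?_)
    (fun z hz => ?_) j
  · exact (differentiableAt_Gamma_comp (by linarith [(hre z hz).1])).differentiableWithinAt
  · exact Complex.Gamma_ne_zero_of_re_pos (by linarith [(hre z hz).1])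
  · obtain ⟨h1, h2⟩ := hre z hz
    refine (norm_Gamma_le_Gamma_re (by linarith)).trans ?_
    refine (Real.Gamma_strictMonoOn_Ici.monotoneOn h1 (by simp; linarith) h2).trans ?_
    refine (Gamma_add_nat_le (by linarith) n).trans_eq ?_
    rw [zero_div, add_zero, Complex.Gamma_ofReal, Complex.norm_real, Real.norm_of_nonneg hΓ.le,
      Real.exp_nat_mul, Real.exp_log (by linarith)]
    congr 2
    ring

/-! ### Positivity and convexity of the Mellin transform for Λ₀ -/

section RealXiMellin

open HurwitzZeta MeasureTheory Set

/-- For x > 1 the modified kernel is θ(x) - 1, a sum of nonnegative exponentials. For x < 1 the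
functional equation of θ reduces to the first case, and at x = 1 both indicators vanish. -/
theorem f_modif_hurwitzEvenFEPair_zero (x : ℝ) (hx : 0 < x) :
    (hurwitzEvenFEPair 0).f_modif x = (‖(hurwitzEvenFEPair 0).f_modif x‖ : ℂ) := by
  have hk : ∀ t : ℝ, 0 < t → 0 ≤ evenKernel 0 t - 1 := by
    intro t ht
    have h := hasSum_int_evenKernel₀ 0 ht
    simp only [QuotientAddGroup.mk_zero, if_true] at h
    exact h.nonneg fun n => by split_ifs <;> positivity
  suffices h : ∃ r : ℝ, 0 ≤ r ∧ (hurwitzEvenFEPair 0).f_modif x = r by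
    obtain ⟨r, hr, h⟩ := h
    rw [h, Complex.norm_real, Real.norm_of_nonneg hr]
  rw [WeakFEPair.f_modif, Pi.add_apply]
  rcases lt_trichotomy 1 x with h1 | rfl | h1
  · rw [indicator_of_mem (mem_Ioi.2 h1), indicator_of_notMem (fun h => lt_asymm h1 h.2)]
    exact ⟨_, hk x hx, by simp [hurwitzEvenFEPair]⟩
  · exact ⟨0, le_rfl, by simp⟩
  · rw [indicator_of_notMem (by simpa using h1.le), indicator_of_mem (mem_Ioo.2 ⟨hx, h1⟩)]
    refine ⟨x ^ (-(1 / 2) : ℝ) * (evenKernel 0 (1 / x) - 1),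
      mul_nonneg (Real.rpow_nonneg hx.le _) (hk _ (by positivity)), ?_⟩
    simp only [hurwitzEvenFEPair, Function.comp_apply, zero_add]
    rw [evenKernel_functional_equation, ← evenKernel_eq_cosKernel_of_zero,
      Real.rpow_neg hx.le]
    push_cast
    simp only [smul_eq_mul]
    ring

/-- The Mellin transform that represents `Λ₀` on the real axis. -/
noncomputable def realXiMellin (σ : ℝ) : ℝ :=
  (∫ t in Ioi (0 : ℝ), t ^ (σ / 2 - 1) * ‖(hurwitzEvenFEPair 0).f_modif t‖) / 2

theorem norm_cpow_smul_f_modif (s : ℂ) {t : ℝ} (ht : 0 < t) :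
    ‖(t : ℂ) ^ (s / 2 - 1) • (hurwitzEvenFEPair 0).f_modif t‖ =
      t ^ (s.re / 2 - 1) * ‖(hurwitzEvenFEPair 0).f_modif t‖ := by
  rw [norm_smul, Complex.norm_cpow_eq_rpow_re_of_pos ht]
  simp

theorem integrableOn_realXiMellin (σ : ℝ) :
    IntegrableOn (fun t => t ^ (σ / 2 - 1) * ‖(hurwitzEvenFEPair 0).f_modif t‖) (Ioi 0) := by
  have h := ((hurwitzEvenFEPair 0).isStrongFEPair_toStrongFEPair.hasMellin (σ / 2)).1.norm
  refine (integrableOn_congr_fun (fun t ht => ?_) measurableSet_Ioi).1 h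
  exact norm_cpow_smul_f_modif σ ht

theorem norm_completedRiemannZeta₀_le (s : ℂ) : ‖completedRiemannZeta₀ s‖ ≤ realXiMellin s.re := by
  rw [completedRiemannZeta₀, completedHurwitzZetaEven₀, WeakFEPair.Λ₀, mellin, norm_div,
    Complex.norm_ofNat, realXiMellin]
  gcongr
  refine (norm_integral_le_integral_norm _).trans_eq ?_
  exact setIntegral_congr_fun measurableSet_Ioi fun t ht => norm_cpow_smul_f_modif s ht

/-- On the real axis the integrand is already nonnegative, so the triangle inequality behind
`norm_completedRiemannZeta₀_le` loses nothing. -/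
theorem completedRiemannZeta₀_ofReal (σ : ℝ) : completedRiemannZeta₀ σ = realXiMellin σ := by
  rw [completedRiemannZeta₀, completedHurwitzZetaEven₀, WeakFEPair.Λ₀, mellin, realXiMellin,
    Complex.ofReal_div, ← integral_complex_ofReal]
  congr 1
  refine setIntegral_congr_fun measurableSet_Ioi fun t (ht : 0 < t) => ?_
  rw [Complex.ofReal_mul, ← f_modif_hurwitzEvenFEPair_zero t ht, Complex.ofReal_cpow ht.le]
  push_cast
  rfl

/-- Powers of t are log-convex in the exponent; weighted AM-GM turns this into convexity under the
integral. -/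
theorem realXiMellin_convex {a b α β : ℝ} (hα : 0 ≤ α) (hβ : 0 ≤ β) (h : α + β = 1) :
    realXiMellin (α * a + β * b) ≤ α * realXiMellin a + β * realXiMellin b := by
  have hi : ∀ σ c : ℝ, IntegrableOn
      (fun t => c * (t ^ (σ / 2 - 1) * ‖(hurwitzEvenFEPair 0).f_modif t‖)) (Ioi 0) :=
    fun σ c => (integrableOn_realXiMellin σ).const_mul c
  have key : ∫ t in Ioi (0 : ℝ), t ^ ((α * a + β * b) / 2 - 1) *
        ‖(hurwitzEvenFEPair 0).f_modif t‖ ≤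
      α * (∫ t in Ioi (0 : ℝ), t ^ (a / 2 - 1) * ‖(hurwitzEvenFEPair 0).f_modif t‖) +
      β * (∫ t in Ioi (0 : ℝ), t ^ (b / 2 - 1) * ‖(hurwitzEvenFEPair 0).f_modif t‖) := by
    rw [← integral_const_mul, ← integral_const_mul, ← integral_add (hi a α) (hi b β)]
    refine setIntegral_mono_on (integrableOn_realXiMellin _) ((hi a α).add (hi b β))
      measurableSet_Ioi fun t (ht : 0 < t) => ?_
    have h1 := Real.geom_mean_le_arith_mean2_weighted hα hβ
      (Real.rpow_nonneg ht.le (a / 2 - 1)) (Real.rpow_nonneg ht.le (b / 2 - 1)) h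
    rw [← Real.rpow_mul ht.le, ← Real.rpow_mul ht.le, ← Real.rpow_add ht] at h1
    have h2 : (α * a + β * b) / 2 - 1 = (a / 2 - 1) * α + (b / 2 - 1) * β := by
      linear_combination h
    rw [h2]
    calc _ ≤ (α * t ^ (a / 2 - 1) + β * t ^ (b / 2 - 1)) *
          ‖(hurwitzEvenFEPair 0).f_modif t‖ := by gcongr
      _ = _ := by ring
  unfold realXiMellin
  linarith

theorem realXiMellin_one_sub (σ : ℝ) : realXiMellin (1 - σ) = realXiMellin σ := by
  have h := completedRiemannZeta₀_one_sub σ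
  rw [← Complex.ofReal_one, ← Complex.ofReal_sub, completedRiemannZeta₀_ofReal,
    completedRiemannZeta₀_ofReal] at h
  exact_mod_cast h

/-- A convex function symmetric about 1/2 is largest at the endpoints of a symmetric interval: write
σ as a convex combination of 1 - b and b. -/
theorem realXiMellin_le {σ b : ℝ} (hb : 1 / 2 < b) (h1 : 1 - b ≤ σ) (h2 : σ ≤ b) :
    realXiMellin σ ≤ realXiMellin b := by
  have hd : 0 < 2 * b - 1 := by linarith
  have h := realXiMellin_convex (a := 1 - b) (b := b) (α := (b - σ) / (2 * b - 1))
    (β := (σ - (1 - b)) / (2 * b - 1)) (div_nonneg (by linarith) hd.le)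
    (div_nonneg (by linarith) hd.le) (by rw [← add_div, div_eq_one_iff_eq hd.ne']; ring)
  rw [realXiMellin_one_sub, ← add_mul] at h
  have e1 : (b - σ) / (2 * b - 1) * (1 - b) + (σ - (1 - b)) / (2 * b - 1) * b = σ := by
    rw [div_mul_eq_mul_div, div_mul_eq_mul_div, ← add_div, div_eq_iff hd.ne']
    ring
  have e2 : (b - σ) / (2 * b - 1) + (σ - (1 - b)) / (2 * b - 1) = 1 := by
    rw [← add_div, div_eq_one_iff_eq hd.ne']; ring
  rwa [e1, e2, one_mul] at h

/-- Since `centredXi 0` equals 1 - Λ₀(1/2)/4, this strict bound excludes a zero at the centre.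
Convexity compares Λ₀(1/2) with the explicit value at 1. -/
theorem realXiMellin_half_lt : realXiMellin (1 / 2) < 4 := by
  have h1 : realXiMellin (1 / 2) ≤ realXiMellin 1 :=
    realXiMellin_le (by norm_num) (by norm_num) (by norm_num)
  have h2 : realXiMellin 1 = (Real.eulerMascheroniConstant - Real.log (4 * Real.pi)) / 2 + 1 := by
    have h := completedRiemannZeta₀_ofReal 1
    rw [Complex.ofReal_one, completedRiemannZeta₀_one] at h
    have h4 : (4 * (Real.pi : ℂ)) = ((4 * Real.pi : ℝ) : ℂ) := by push_cast; rfl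
    rw [h4, ← Complex.ofReal_log (by positivity)] at h
    exact_mod_cast h.symm
  have h3 : 0 ≤ Real.log (4 * Real.pi) := Real.log_nonneg (by linarith [Real.pi_gt_three])
  have h4 := Real.eulerMascheroniConstant_lt_two_thirds
  linarith

end RealXiMellin

/-! ### The centred ξ function: factorisation, growth, infinitely many zeros -/

/-- The entire function `z ↦ s (s - 1) Λ(s)`, `s = 1 / 2 + z`: twice the Riemann `ξ` function,
centred at the symmetry point of the functional equation. -/
noncomputable def centredXi (z : ℂ) : ℂ :=
  (1 / 2 + z) * (z - 1 / 2) * completedRiemannZeta₀ (1 / 2 + z) + 1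

theorem differentiable_centredXi : Differentiable ℂ centredXi := by
  have := differentiable_completedZeta₀
  unfold centredXi
  fun_prop

theorem centredXi_neg (z : ℂ) : centredXi (-z) = centredXi z := by
  have h := completedRiemannZeta₀_one_sub (1 / 2 + z)
  rw [show 1 - (1 / 2 + z) = 1 / 2 + -z by ring] at h
  rw [centredXi, centredXi, h]
  ring

/-- Using Γ(s/2 + 1) rather than Γ(s/2) absorbs the factor s, so the formula holds across s = 0 and
fails only from the first trivial zero s = -2 on, apart from s = 1. -/
theorem centredXi_eq (s : ℂ) (h1 : s ≠ 1) (hs : -2 < s.re) :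
    centredXi (s - 1 / 2) =
      2 * (s - 1) * (Real.pi : ℂ) ^ (-s / 2) * Complex.Gamma (s / 2 + 1) * riemannZeta s := by
  have hΓ : Complex.Gamma (s / 2 + 1) ≠ 0 := by
    refine Complex.Gamma_ne_zero_of_re_pos ?_
    simp only [Complex.add_re, Complex.div_ofNat_re, Complex.one_re]
    linarith
  have hπ : (Real.pi : ℂ) ^ (-s / 2) ≠ 0 := by
    simp [Complex.cpow_eq_zero_iff, Real.pi_ne_zero]
  have h2 : 1 - s ≠ 0 := sub_ne_zero.2 h1.symm
  rw [riemannZeta_eq_mul_completedRiemannZeta₀, centredXi, add_sub_cancel]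
  generalize Complex.Gamma (s / 2 + 1) = g at hΓ ⊢
  generalize (Real.pi : ℂ) ^ (-s / 2) = p at hπ ⊢
  field_simp
  ring

theorem centredXi_zero_ne_zero : centredXi 0 ≠ 0 := by
  intro h
  have h1 : completedRiemannZeta₀ ((1 / 2 : ℝ) : ℂ) = realXiMellin (1 / 2) :=
    completedRiemannZeta₀_ofReal _
  have h2 : realXiMellin (1 / 2) = 4 := by
    rw [centredXi] at h
    push_cast at h1
    rw [add_zero, h1] at h
    have : (realXiMellin (1 / 2) : ℂ) = (4 : ℝ) := by
      push_cast
      linear_combination (-4) * h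
    exact_mod_cast this
  exact realXiMellin_half_lt.ne h2

theorem norm_riemannZeta_nat {k : ℕ} (hk : 2 ≤ k) :
    1 ≤ ‖riemannZeta k‖ ∧ ‖riemannZeta k‖ ≤ ∑' n : ℕ, 1 / (n : ℝ) ^ 2 := by
  have hs : ∀ {k : ℕ}, 2 ≤ k → Summable fun n : ℕ => 1 / (n : ℝ) ^ k := fun hk =>
    Real.summable_one_div_nat_pow.2 (by omega)
  have h : riemannZeta k = ((∑' n : ℕ, 1 / (n : ℝ) ^ k : ℝ) : ℂ) := by
    rw [zeta_nat_eq_tsum_of_gt_one (by omega), Complex.ofReal_tsum]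
    simp
  rw [h, Complex.norm_real, Real.norm_of_nonneg (tsum_nonneg fun n => by positivity)]
  refine ⟨?_, (hs hk).tsum_le_tsum (fun n => ?_) (hs le_rfl)⟩
  · have := (hs hk).le_tsum 1 fun n _ => by positivity
    simpa using this
  · rcases Nat.eq_zero_or_pos n with rfl | hn
    · simp [show k ≠ 0 by omega]
    · have hn' : (1 : ℝ) ≤ n := by exact_mod_cast hn
      exact one_div_le_one_div_of_le (by positivity) (pow_le_pow_right₀ hn' hk)

/-- At s = 2n + 2 the Gamma factor is a factorial. This value serves both for the upper bound on
growth and for the lower bound that forces infinitely many zeros. -/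
theorem norm_centredXi_even (n : ℕ) :
    ‖centredXi ((2 * n + 3 / 2 : ℝ) : ℂ)‖ =
      2 * (2 * n + 1) * (Real.pi ^ (n + 1))⁻¹ * (n + 1)! * ‖riemannZeta (2 * n + 2 : ℕ)‖ := by
  have h := centredXi_eq (2 * n + 2 : ℕ) (by norm_cast; omega) (by
    rw [Complex.natCast_re]; linarith [(2 * n + 2 : ℕ).cast_nonneg (α := ℝ)])
  have e1 : ((2 * n + 2 : ℕ) : ℂ) - 1 / 2 = ((2 * n + 3 / 2 : ℝ) : ℂ) := by push_cast; ring
  have e2 : -((2 * n + 2 : ℕ) : ℂ) / 2 = -((n + 1 : ℕ) : ℂ) := by push_cast; ring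
  have e3 : ((2 * n + 2 : ℕ) : ℂ) / 2 + 1 = ((n + 1 : ℕ) : ℂ) + 1 := by push_cast; ring
  have e4 : ((2 * n + 2 : ℕ) : ℂ) - 1 = ((2 * n + 1 : ℕ) : ℂ) := by push_cast; ring
  rw [e1, e2, e3, e4, Complex.Gamma_nat_eq_factorial, Complex.cpow_neg, Complex.cpow_natCast] at h
  rw [h]
  simp only [norm_mul, norm_inv, norm_pow, Complex.norm_natCast, Complex.norm_real,
    Real.norm_of_nonneg Real.pi_pos.le, Complex.norm_ofNat]
  push_cast
  ring

/-- The circle |z| = 2n lies in the strip 1 - b ≤ Re s ≤ b with b = 2n + 2, so Λ₀ is bounded there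
by its value at b, which is read off from `norm_centredXi_even`. -/
theorem norm_centredXi_le_factorial (n : ℕ) (z : ℂ) (hz : ‖z‖ = 2 * n) :
    ‖centredXi z‖ ≤
      (2 * (∑' n : ℕ, 1 / (n : ℝ) ^ 2) + 2) * (2 + 2 * n : ℝ) ^ (n + 4) := by
  set Z := ∑' n : ℕ, 1 / (n : ℝ) ^ 2 with hZ
  have hZ1 : 1 ≤ Z := (norm_riemannZeta_nat le_rfl).1.trans (norm_riemannZeta_nat le_rfl).2
  set y : ℝ := 2 + 2 * n with hy
  have hn0 : (0 : ℝ) ≤ n := n.cast_nonneg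
  have hy1 : 1 ≤ y := by linarith
  have hX : ‖centredXi ((2 * n + 3 / 2 : ℝ) : ℂ)‖ ≤ 2 * Z * y ^ (n + 2) := by
    rw [norm_centredXi_even]
    have h1 : (Real.pi ^ (n + 1))⁻¹ ≤ 1 :=
      inv_le_one_of_one_le₀ (one_le_pow₀ (by linarith [Real.pi_gt_three]))
    have h2 : ((n + 1)! : ℝ) ≤ y ^ (n + 1) := by
      have : ((n + 1)! : ℝ) ≤ ((n + 1 : ℕ) : ℝ) ^ (n + 1) := by
        exact_mod_cast Nat.factorial_le_pow (n + 1)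
      refine this.trans (pow_le_pow_left₀ (by positivity) ?_ _)
      push_cast
      linarith
    have h3 := (norm_riemannZeta_nat (k := 2 * n + 2) (by omega)).2
    calc _ ≤ 2 * y * 1 * y ^ (n + 1) * Z := by gcongr; linarith
      _ = _ := by ring
  have hK : realXiMellin (2 * n + 2) ≤ 2 * Z * y ^ (n + 2) + 1 := by
    have h1 := completedRiemannZeta₀_ofReal (2 * n + 2)
    have h2 : centredXi ((2 * n + 3 / 2 : ℝ) : ℂ) =
        (((2 * n + 2) * (2 * n + 1) * realXiMellin (2 * n + 2) + 1 : ℝ) : ℂ) := by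
      rw [centredXi]
      have e : (1 / 2 : ℂ) + ((2 * n + 3 / 2 : ℝ) : ℂ) = ((2 * n + 2 : ℝ) : ℂ) := by
        push_cast; ring
      rw [e, h1]
      push_cast
      ring
    rw [h2, Complex.norm_real] at hX
    have h3 := (le_abs_self _).trans hX
    have h4 : 0 ≤ 2 * Z * y ^ (n + 2) := by positivity
    -- The coefficient (2n + 2)(2n + 1) is at least 2, so it may be dropped.
    by_contra hlt
    push Not at hlt
    nlinarith [mul_nonneg hn0 hn0]
  have hΛ : ‖completedRiemannZeta₀ (1 / 2 + z)‖ ≤ 2 * Z * y ^ (n + 2) + 1 := by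
    have hre := abs_le.1 ((Complex.abs_re_le_norm z).trans_eq hz)
    refine (norm_completedRiemannZeta₀_le _).trans ((realXiMellin_le (by linarith) ?_ ?_).trans hK)
    all_goals
      simp only [Complex.add_re, Complex.div_ofNat_re, Complex.one_re]
      linarith
  have ha : ‖1 / 2 + z‖ ≤ y := by
    refine (norm_add_le _ _).trans ?_
    rw [hz]
    norm_num
    linarith
  have hb : ‖z - 1 / 2‖ ≤ y := by
    refine (norm_sub_le _ _).trans ?_
    rw [hz]
    norm_num
    linarith
  calc ‖centredXi z‖ ≤ y * y * (2 * Z * y ^ (n + 2) + 1) + 1 := by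
        rw [centredXi]
        refine (norm_add_le _ _).trans ?_
        rw [norm_mul, norm_mul, norm_one]
        gcongr
    _ = 2 * Z * y ^ (n + 4) + y ^ 2 + 1 := by ring
    _ ≤ 2 * Z * y ^ (n + 4) + y ^ (n + 4) + y ^ (n + 4) := by
        gcongr
        · omega
        · exact one_le_pow₀ hy1
    _ = _ := by ring

/-- `centredXi` has order of growth less than two along a sequence of circles. -/
theorem exists_centredXi_growth : ∃ M : ℕ → ℝ, (∀ n, 0 ≤ M n) ∧ (∀ n, 1 ≤ n → 0 < M n) ∧
    Tendsto (fun n : ℕ => M n / (n : ℝ) ^ 2) atTop (𝓝 0) ∧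
    ∀ n : ℕ, 1 ≤ n → ∀ z : ℂ, ‖z‖ = 2 * n → ‖centredXi z‖ ≤ Real.exp (M n) * ‖centredXi 0‖ := by
  set Z := ∑' n : ℕ, 1 / (n : ℝ) ^ 2 with hZ
  have hZ1 : 0 ≤ Z := tsum_nonneg fun n => by positivity
  have hX0 : 0 < ‖centredXi 0‖ := norm_pos_iff.2 centredXi_zero_ne_zero
  -- The summand 1 makes log A ≥ 0; the quotient converts the absolute bound into one relative to
  -- the value at the centre.
  set A := 1 + (2 * Z + 2) / ‖centredXi 0‖ with hA
  have hA1 : 1 ≤ A := by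
    have : 0 ≤ (2 * Z + 2) / ‖centredXi 0‖ := by positivity
    linarith
  have hAX : 2 * Z + 2 ≤ A * ‖centredXi 0‖ := by
    rw [hA, add_mul, div_mul_cancel₀ _ hX0.ne']
    linarith
  have hlog : ∀ n : ℕ, 0 < Real.log (2 + 2 * n) := fun n =>
    Real.log_pos (by linarith [n.cast_nonneg (α := ℝ)])
  -- The factor 5 comes from n + 4 ≤ 5n for n ≥ 1.
  refine ⟨fun n => Real.log A + 5 * (n * Real.log (2 + 2 * n)), fun n => ?_, fun n hn => ?_, ?_, ?_⟩
  · have := hlog n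
    have := Real.log_nonneg hA1
    positivity
  · have := hlog n
    have := Real.log_nonneg hA1
    have : (0 : ℝ) < n := by exact_mod_cast hn
    positivity
  · have h1 : Tendsto (fun n : ℕ => Real.log A / (n : ℝ) ^ 2) atTop (𝓝 0) :=
      ((tendsto_pow_atTop two_ne_zero).comp tendsto_natCast_atTop_atTop).const_div_atTop _
    have h2 := h1.add ((tendsto_mul_log_div_sq 2 2 one_le_two two_pos).const_mul 5)
    rw [mul_zero, add_zero] at h2
    refine h2.congr fun n => ?_
    ring
  · intro n hn z hz
    refine (norm_centredXi_le_factorial n z hz).trans ?_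
    have hy : (0 : ℝ) < 2 + 2 * n := by positivity
    have hy1 : (1 : ℝ) ≤ 2 + 2 * n := by linarith [n.cast_nonneg (α := ℝ)]
    have e : Real.exp (Real.log A + 5 * (n * Real.log (2 + 2 * n))) =
        A * (2 + 2 * n : ℝ) ^ (5 * n) := by
      rw [Real.exp_add, Real.exp_log (by linarith), ← mul_assoc]
      have : (5 * (n : ℝ)) = ((5 * n : ℕ) : ℝ) := by push_cast; ring
      rw [this, Real.exp_nat_mul, Real.exp_log hy]
    rw [e]
    calc (2 * Z + 2) * (2 + 2 * n : ℝ) ^ (n + 4)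
        ≤ (A * ‖centredXi 0‖) * (2 + 2 * n : ℝ) ^ (5 * n) := by
          gcongr
          omega
      _ = _ := by ring

/-- `centredXi` has infinitely many zeros. -/
theorem infinite_centredXi_zeros : {z | centredXi z = 0}.Infinite := by
  intro hfin
  obtain ⟨M, hM0, hM1, hM2, hM3⟩ := exists_centredXi_growth
  have hF := differentiable_centredXi
  have ht : ∀ w, analyticOrderAt centredXi w ≠ ⊤ := by
    intro w hw
    have := (AnalyticOnNhd.analyticOrderAt_eq_top_iff_eq_zero w (fun z => hF.analyticAt z)).1 hw
    exact centredXi_zero_ne_zero (by simp [this])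
  set S := hfin.toFinset with hS
  obtain ⟨G, hG, hGS, hFG⟩ := exists_entire_eq_prod_mul hF ht S
  have hG0 : ∀ z, G z ≠ 0 := by
    intro z hz
    refine hGS z ?_ hz
    rw [hS, Set.Finite.mem_toFinset, Set.mem_ofPred_eq, hFG, hz, mul_zero]
  obtain ⟨B, hB⟩ : ∃ B : ℝ, ∀ w ∈ S, ‖w‖ ≤ B :=
    ⟨∑ w ∈ S, ‖w‖, fun w hw => Finset.single_le_sum (fun i _ => norm_nonneg i) hw⟩
  obtain ⟨c, hc⟩ := eq_mul_exp_of_growth hG hG0 (M := M)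
    (fun j hj => tendsto_cauchy_bound hM0 hM2 hj) (by
      filter_upwards [eventually_ge_atTop 1, tendsto_natCast_atTop_atTop.eventually_ge_atTop B]
        with n hn hnB
      exact ⟨hM1 n hn, norm_cofactor_le hG hFG centredXi_zero_ne_zero (by exact_mod_cast hn)
        (fun w hw => (hB w hw).trans hnB) (hM3 n hn)⟩)
  -- With finitely many zeros, `centredXi` is a polynomial times e^(cz), hence of exponential type.
  obtain ⟨D, E, hD, hE, hDE⟩ : ∃ D E : ℝ, 0 ≤ D ∧ 0 < E ∧
      ∀ z, ‖centredXi z‖ ≤ E * Real.exp (D * ‖z‖) := by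
    refine ⟨∑ w ∈ S, (analyticOrderNatAt centredXi w : ℝ) + ‖c‖,
      Real.exp (∑ w ∈ S, analyticOrderNatAt centredXi w * ‖w‖) * ‖G 0‖, by positivity,
      mul_pos (Real.exp_pos _) (norm_pos_iff.2 (hG0 0)), fun z => ?_⟩
    rw [hFG z, hc z, norm_mul, norm_mul, norm_prod]
    have h1 : ∏ w ∈ S, ‖(z - w) ^ analyticOrderNatAt centredXi w‖ ≤
        Real.exp (∑ w ∈ S, analyticOrderNatAt centredXi w * (‖z‖ + ‖w‖)) := by
      rw [Real.exp_sum]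
      refine Finset.prod_le_prod (fun _ _ => norm_nonneg _) fun w _ => ?_
      rw [norm_pow, Real.exp_nat_mul]
      refine pow_le_pow_left₀ (norm_nonneg _) ((norm_sub_le _ _).trans ?_) _
      linarith [Real.add_one_le_exp (‖z‖ + ‖w‖)]
    have h2 : ‖Complex.exp (c * z)‖ ≤ Real.exp (‖c‖ * ‖z‖) :=
      (Complex.norm_exp_le_exp_norm _).trans_eq (by rw [norm_mul])
    refine (mul_le_mul h1 (mul_le_mul_of_nonneg_left h2 (norm_nonneg _)) (by positivity)
      (Real.exp_pos _).le).trans_eq ?_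
    simp only [mul_add, add_mul, Finset.sum_add_distrib, Real.exp_add, Finset.sum_mul]
    ring
  have hlim := FloorSemiring.tendsto_pow_div_factorial_atTop (Real.pi * Real.exp (2 * D))
  -- Exponential type at z = 2n + 3/2 would bound (n + 1)! by a geometric sequence, against the
  -- limit `hlim`.
  have hlow : ∀ n : ℕ, (E * Real.exp (2 * D))⁻¹ ≤
      (Real.pi * Real.exp (2 * D)) ^ (n + 1) / (n + 1)! := by
    intro n
    have h1 := hDE ((2 * n + 3 / 2 : ℝ) : ℂ)
    rw [norm_centredXi_even, Complex.norm_real,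
      Real.norm_of_nonneg (by positivity : (0 : ℝ) ≤ 2 * n + 3 / 2)] at h1
    have h2 := (norm_riemannZeta_nat (k := 2 * n + 2) (by omega)).1
    have hπ : 0 < (Real.pi ^ (n + 1))⁻¹ := inv_pos.2 (pow_pos Real.pi_pos _)
    have h3 : 1 * (Real.pi ^ (n + 1))⁻¹ * (n + 1)! * 1 ≤
        2 * (2 * n + 1) * (Real.pi ^ (n + 1))⁻¹ * (n + 1)! * ‖riemannZeta (2 * n + 2 : ℕ)‖ := by
      gcongr
      linarith [n.cast_nonneg (α := ℝ)]
    have h4 : Real.exp (D * (2 * n + 3 / 2)) ≤ Real.exp (2 * D) * Real.exp (2 * D) ^ (n + 1) := by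
      rw [← pow_succ', ← Real.exp_nat_mul, Real.exp_le_exp]
      push_cast
      nlinarith
    have h5 : (Real.pi ^ (n + 1))⁻¹ * (n + 1)! ≤
        E * (Real.exp (2 * D) * Real.exp (2 * D) ^ (n + 1)) := by
      have := h3.trans (h1.trans (mul_le_mul_of_nonneg_left h4 hE.le))
      linarith
    rw [inv_le_iff_one_le_mul₀ (by positivity), mul_pow]
    have hf : (0 : ℝ) < (n + 1)! := by positivity
    rw [inv_mul_eq_div, div_le_iff₀ (pow_pos Real.pi_pos _)] at h5
    rw [div_mul_eq_mul_div, one_le_div hf]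
    linarith
  have h6 := ge_of_tendsto' ((tendsto_add_atTop_iff_nat 1).2 hlim) hlow
  have : 0 < (E * Real.exp (2 * D))⁻¹ := by positivity
  linarith

/-! ### The counting function and the sequence of ordinates -/

open MeasureTheory in
/-- Two finite weighted families of reals with the same counting function have the same sums. -/
theorem sum_mul_comp_eq_of_card_le_eq {ι κ : Type*} (s : Finset ι) (w : ι → ℕ) (a : ι → ℝ)
    (t : Finset κ) (b : κ → ℝ)
    (h : ∀ y, ∑ i ∈ s with a i ≤ y, w i = (t.filter fun k => b k ≤ y).card) (g : ℝ → ℝ) :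
    ∑ i ∈ s, (w i : ℝ) * g (a i) = ∑ k ∈ t, g (b k) := by
  -- Both families are encoded as finite sums of point masses, and a finite measure on the line is
  -- determined by its distribution function.
  have hμ : (∑ i ∈ s, (w i : ENNReal) • Measure.dirac (a i)) = ∑ k ∈ t, Measure.dirac (b k) := by
    have : IsFiniteMeasure (∑ i ∈ s, (w i : ENNReal) • Measure.dirac (a i)) := by
      refine ⟨?_⟩
      rw [Measure.finsetSum_apply]
      exact ENNReal.sum_lt_top.2 fun i _ => by simp
    refine Measure.ext_of_Iic _ _ fun y => ?_
    rw [Measure.finsetSum_apply, Measure.finsetSum_apply]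
    have h1 : ∀ i, ((w i : ENNReal) • Measure.dirac (a i)) (Set.Iic y) =
        ((if a i ≤ y then w i else 0 : ℕ) : ENNReal) := by
      intro i
      rw [Measure.smul_apply, Measure.dirac_apply' _ measurableSet_Iic]
      split_ifs with hi <;> simp [hi]
    have h2 : ∀ k, Measure.dirac (b k) (Set.Iic y) = ((if b k ≤ y then 1 else 0 : ℕ) : ENNReal) := by
      intro k
      rw [Measure.dirac_apply' _ measurableSet_Iic]
      split_ifs with hk <;> simp [hk]
    simp only [h1, h2, ← Nat.cast_sum]
    rw [← Finset.sum_filter, h y, Finset.card_filter]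
  have hint : ∀ x : ℝ, Integrable g (Measure.dirac x) := fun x => integrable_dirac (by simp)
  have h3 := congrArg (fun μ => ∫ x, g x ∂μ) hμ
  rw [integral_finsetSum_measure fun i _ => (hint _).smul_measure (by simp),
    integral_finsetSum_measure fun i _ => hint _] at h3
  simpa using h3

theorem mem_nontrivialZeros_toFinset {T : ℝ} {ρ : ℂ} :
    ρ ∈ (nontrivialZerosUpTo_finite T).toFinset ↔
      riemannZeta ρ = 0 ∧ 0 < ρ.re ∧ ρ.re < 1 ∧ 0 < ρ.im ∧ ρ.im ≤ T :=
  Set.Finite.mem_toFinset _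

theorem filter_im_le_nontrivialZeros (T y : ℝ) :
    ((nontrivialZerosUpTo_finite T).toFinset.filter fun ρ => ρ.im ≤ y) =
      (nontrivialZerosUpTo_finite (min T y)).toFinset := by
  ext ρ
  simp only [Finset.mem_filter, mem_nontrivialZeros_toFinset, le_min_iff]
  tauto

theorem zeroCount_mono : Monotone zeroCount := fun T T' h =>
  Finset.sum_le_sum_of_subset fun ρ hρ => by
    rw [mem_nontrivialZeros_toFinset] at hρ ⊢
    exact ⟨hρ.1, hρ.2.1, hρ.2.2.1, hρ.2.2.2.1, hρ.2.2.2.2.trans h⟩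

theorem zeroCount_of_nonpos {T : ℝ} (hT : T ≤ 0) : zeroCount T = 0 := by
  refine Finset.sum_eq_zero fun ρ hρ => ?_
  rw [mem_nontrivialZeros_toFinset] at hρ
  linarith [hρ.2.2.2.1, hρ.2.2.2.2]

/-- Right-continuity of N(T), in the form needed to see that the infimum defining an ordinate is
attained: finitely many zeros below T + 1 leave a gap above T. -/
theorem exists_zeroCount_eq (T : ℝ) : ∃ T' > T, zeroCount T' = zeroCount T := by
  have h : ∀ᶠ T' in 𝓝[>] T, ∀ ρ ∈ (nontrivialZerosUpTo_finite (T + 1)).toFinset,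
      ρ.im ≤ T' → ρ.im ≤ T := by
    rw [Filter.eventually_all_finset]
    intro ρ _
    rcases le_or_gt ρ.im T with h | h
    · exact Eventually.of_forall fun _ _ => h
    · filter_upwards [Ioo_mem_nhdsGT h] with T' hT' hle
      exact absurd hle (not_le.2 hT'.2)
  obtain ⟨T', h1, h2⟩ := (h.and (Ioo_mem_nhdsGT (lt_add_one T))).exists
  refine ⟨T', h2.1, le_antisymm (Finset.sum_le_sum_of_subset fun ρ hρ => ?_)
    (zeroCount_mono h2.1.le)⟩
  have hρ' := hρ
  rw [mem_nontrivialZeros_toFinset] at hρ ⊢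
  refine ⟨hρ.1, hρ.2.1, hρ.2.2.1, hρ.2.2.2.1, h1 ρ ?_ hρ.2.2.2.2⟩
  rw [mem_nontrivialZeros_toFinset]
  exact ⟨hρ.1, hρ.2.1, hρ.2.2.1, hρ.2.2.2.1, hρ.2.2.2.2.trans h2.2.le⟩

/-- The ordinates are the generalized inverse of the counting function. -/
theorem zeroOrdinate_le_iff (hub : Tendsto zeroCount atTop atTop) {n : ℕ} (hn : 1 ≤ n) (T : ℝ) :
    zeroOrdinate n ≤ T ↔ n ≤ zeroCount T := by
  have hbdd : BddBelow {T : ℝ | n ≤ zeroCount T} := by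
    refine ⟨0, fun T (hT : n ≤ zeroCount T) => ?_⟩
    by_contra hlt
    rw [zeroCount_of_nonpos (not_le.1 hlt).le] at hT
    omega
  have hne : {T : ℝ | n ≤ zeroCount T}.Nonempty := (hub.eventually_ge_atTop n).exists
  refine ⟨fun h => ?_, fun h => csInf_le hbdd h⟩
  obtain ⟨T', hT', he⟩ := exists_zeroCount_eq T
  obtain ⟨T₁, h1, h2⟩ := exists_lt_of_csInf_lt hne (lt_of_le_of_lt h hT')
  rw [← he]
  exact le_trans h1 (zeroCount_mono h2.le)

theorem zeroOrdinate_pos (hub : Tendsto zeroCount atTop atTop) {n : ℕ} (hn : 1 ≤ n) :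
    0 < zeroOrdinate n := by
  by_contra h
  rw [not_lt, zeroOrdinate_le_iff hub hn, zeroCount_of_nonpos le_rfl] at h
  omega

theorem zeroOrdinate_le_of_le (hub : Tendsto zeroCount atTop atTop) {n k : ℕ} (hn : 1 ≤ n)
    (hk : n ≤ k) : zeroOrdinate n ≤ zeroOrdinate k := by
  rw [zeroOrdinate_le_iff hub hn]
  exact hk.trans ((zeroOrdinate_le_iff hub (hn.trans hk) _).1 le_rfl)

/-- Sums over zeros with multiplicity are sums over the sequence of ordinates. -/
theorem sum_nontrivialZeros_eq_sum_zeroOrdinate (hub : Tendsto zeroCount atTop atTop) (T : ℝ)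
    (g : ℝ → ℝ) :
    ∑ ρ ∈ (nontrivialZerosUpTo_finite T).toFinset, (analyticOrderNatAt riemannZeta ρ : ℝ) * g ρ.im =
      ∑ k ∈ Finset.range (zeroCount T), g (zeroOrdinate (k + 1)) := by
  refine sum_mul_comp_eq_of_card_le_eq _ _ (fun ρ : ℂ => ρ.im) _ (fun k => zeroOrdinate (k + 1))
    (fun y => ?_) g
  have : (Finset.range (zeroCount T)).filter (fun k => zeroOrdinate (k + 1) ≤ y) =
      Finset.range (zeroCount (min T y)) := by
    ext k
    rw [Finset.mem_filter, Finset.mem_range, Finset.mem_range, zeroOrdinate_le_iff hub (by omega),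
      zeroCount_mono.map_min, lt_min_iff, Nat.lt_iff_add_one_le, Nat.lt_iff_add_one_le]
  rw [this, Finset.card_range, filter_im_le_nontrivialZeros, zeroCount]

theorem hasSum_zeroOrdinate_of_tendsto (hub : Tendsto zeroCount atTop atTop) {g : ℝ → ℝ}
    (hg : ∀ y, 0 ≤ g y) {L : ℝ}
    (hL : Tendsto (fun n : ℕ => ∑ ρ ∈ (nontrivialZerosUpTo_finite n).toFinset,
      (analyticOrderNatAt riemannZeta ρ : ℝ) * g ρ.im) atTop (𝓝 L)) :
    HasSum (fun k : ℕ => g (zeroOrdinate (k + 1))) L := by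
  rw [hasSum_iff_tendsto_nat_of_nonneg fun k => hg _]
  have hmono : Monotone fun n => ∑ k ∈ Finset.range n, g (zeroOrdinate (k + 1)) :=
    fun a b hab => Finset.sum_le_sum_of_subset_of_nonneg (Finset.range_mono hab) fun _ _ _ => hg _
  -- Partial sums of nonnegative terms are monotone, so convergence along the indices N(n), which
  -- tend to infinity, is enough.
  rw [tendsto_iff_tendsto_subseq_of_monotone hmono (hub.comp tendsto_natCast_atTop_atTop)]
  exact hL.congr fun n => sum_nontrivialZeros_eq_sum_zeroOrdinate hub n g

/-! ### Recovering a sequence from its power sums -/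

/-- The terms of a sequence are recovered successively from its power sums. -/
theorem tendsto_tail_rpow {t : ℕ → ℝ} {Z : ℕ → ℝ} (n : ℕ) (hpos : 0 < t (n + 1))
    (hmono : ∀ k, t (n + 1) ≤ t (k + n + 1))
    (hZ : ∀ m : ℕ, 1 ≤ m → HasSum (fun k : ℕ => 1 / t (k + 1) ^ (2 * m)) (Z m)) :
    Tendsto (fun m : ℕ => (Z m - ∑ k ∈ Finset.Icc 1 n, 1 / t k ^ (2 * m)) ^ (-(1 / (2 * (m : ℝ)))))
      atTop (𝓝 (t (n + 1))) := by
  set τ := t (n + 1) with hτ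
  set S : ℕ → ℝ := fun m => Z m - ∑ k ∈ Finset.Icc 1 n, 1 / t k ^ (2 * m) with hS
  have hS1 : ∀ m : ℕ, 1 ≤ m → HasSum (fun k : ℕ => 1 / t (k + n + 1) ^ (2 * m)) (S m) := by
    intro m hm
    have h := (hasSum_nat_add_iff' n).2 (hZ m hm)
    have e : ∑ k ∈ Finset.Icc 1 n, 1 / t k ^ (2 * m) =
        ∑ k ∈ Finset.range n, 1 / t (k + 1) ^ (2 * m) := by
      rw [Finset.range_eq_Ico, Finset.sum_Ico_add' (fun k => 1 / t k ^ (2 * m)) 0 n 1]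
      rfl
    simpa only [hS, e] using h
  have hlow : ∀ m : ℕ, 1 ≤ m → (τ ^ (2 * m))⁻¹ ≤ S m := by
    intro m hm
    have h := le_hasSum (hS1 m hm) 0 fun k _ => by
      have := hpos.trans_le (hmono k)
      positivity
    simpa [hτ] using h
  -- Keep one factor t_k^(-2) for convergence and bound the other 2m - 2 powers by those of the
  -- least term τ.
  have hup : ∀ m : ℕ, 1 ≤ m → S m ≤ (τ ^ (2 * m))⁻¹ * (τ ^ 2 * S 1) := by
    intro m hm
    have h1 := ((hS1 1 le_rfl).mul_left (τ ^ 2)).mul_left ((τ ^ (2 * m))⁻¹)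
    refine hasSum_le (fun k => ?_) (hS1 m hm) h1
    have hk := hmono k
    have hk0 := hpos.trans_le hk
    obtain ⟨l, rfl⟩ : ∃ l, m = l + 1 := ⟨m - 1, by omega⟩
    have e1 : 1 / t (k + n + 1) ^ (2 * (l + 1)) =
        1 / t (k + n + 1) ^ (2 * l) * (1 / t (k + n + 1) ^ 2) := by
      rw [mul_add, mul_one, pow_add]
      field_simp
    have e2 : (τ ^ (2 * (l + 1)))⁻¹ * (τ ^ 2 * (1 / t (k + n + 1) ^ (2 * 1))) =
        1 / τ ^ (2 * l) * (1 / t (k + n + 1) ^ 2) := by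
      rw [mul_add, mul_one, pow_add]
      field_simp
    rw [e1, e2]
    gcongr
  have hC : 0 < τ ^ 2 * S 1 := by
    have := (inv_pos.2 (pow_pos hpos _)).trans_le (hlow 1 le_rfl)
    positivity
  have hroot : ∀ m : ℕ, 1 ≤ m → ((τ ^ (2 * m))⁻¹) ^ (-(1 / (2 * (m : ℝ)))) = τ := by
    intro m hm
    have hm0 : (m : ℝ) ≠ 0 := by positivity
    rw [Real.rpow_neg (by positivity), Real.inv_rpow (by positivity), inv_inv, ← Real.rpow_natCast,
      ← Real.rpow_mul hpos.le]
    push_cast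
    rw [mul_one_div_cancel (by positivity), Real.rpow_one]
  have hexp : Tendsto (fun m : ℕ => -(1 / (2 * (m : ℝ)))) atTop (𝓝 0) := by
    have h : Tendsto (fun m : ℕ => 2 * (m : ℝ)) atTop atTop :=
      tendsto_natCast_atTop_atTop.const_mul_atTop two_pos
    simpa using (h.const_div_atTop 1).neg
  have hlim : Tendsto (fun m : ℕ => τ * (τ ^ 2 * S 1) ^ (-(1 / (2 * (m : ℝ))))) atTop (𝓝 τ) := by
    have h := (Real.continuous_const_rpow hC.ne').continuousAt.tendsto.comp hexp
    simpa using h.const_mul τ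
  -- The exponent is negative, so the upper bound on `S m` gives the lower bound on the root and
  -- conversely.
  refine tendsto_of_tendsto_of_tendsto_of_le_of_le' hlim tendsto_const_nhds ?_ ?_
  · filter_upwards [eventually_ge_atTop 1] with m hm
    have hp : 0 < (τ ^ (2 * m))⁻¹ := inv_pos.2 (pow_pos hpos _)
    have hneg : -(1 / (2 * (m : ℝ))) ≤ 0 := neg_nonpos.2 (by positivity)
    calc τ * (τ ^ 2 * S 1) ^ (-(1 / (2 * (m : ℝ))))
        = ((τ ^ (2 * m))⁻¹ * (τ ^ 2 * S 1)) ^ (-(1 / (2 * (m : ℝ)))) := by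
          rw [Real.mul_rpow hp.le hC.le, hroot m hm]
      _ ≤ S m ^ (-(1 / (2 * (m : ℝ)))) :=
          Real.rpow_le_rpow_of_nonpos (hp.trans_le (hlow m hm)) (hup m hm) hneg
  · filter_upwards [eventually_ge_atTop 1] with m hm
    have hp : 0 < (τ ^ (2 * m))⁻¹ := inv_pos.2 (pow_pos hpos _)
    have hneg : -(1 / (2 * (m : ℝ))) ≤ 0 := neg_nonpos.2 (by positivity)
    exact (Real.rpow_le_rpow_of_nonpos hp (hlow m hm) hneg).trans_eq (hroot m hm)

/-! ### Zeros of the centred ξ function under RH -/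

theorem centredXi_half : centredXi (1 / 2) = 1 := by simp [centredXi]

theorem analyticOrderAt_centredXi_ne_top (w : ℂ) : analyticOrderAt centredXi w ≠ ⊤ := by
  intro hw
  have := (AnalyticOnNhd.analyticOrderAt_eq_top_iff_eq_zero w
    (fun z => differentiable_centredXi.analyticAt z)).1 hw
  exact centredXi_zero_ne_zero (by simp [this])

theorem re_eq_half_of_riemannZeta_eq_zero (hRH : RiemannHypothesis) {s : ℂ}
    (hs : riemannZeta s = 0) (hre : 0 < s.re) : s.re = 1 / 2 := by
  refine hRH s hs ?_ ?_
  · rintro ⟨n, rfl⟩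
    have : (-2 * ((n : ℂ) + 1)).re = -2 * ((n : ℝ) + 1) := by simp
    rw [this] at hre
    linarith [n.cast_nonneg (α := ℝ)]
  · rintro rfl
    exact riemannZeta_one_ne_zero hs

/-- Evenness reduces to Re z ≥ 0, that is Re s ≥ 1/2. There all factors besides ζ are nonzero away
from s = 1, trivial zeros do not occur, and RH forces Re s = 1/2. -/
theorem centredXi_eq_zero_iff (hRH : RiemannHypothesis) (z : ℂ) :
    centredXi z = 0 ↔ z.re = 0 ∧ riemannZeta (1 / 2 + z) = 0 := by
  have key : ∀ z : ℂ, 0 ≤ z.re → centredXi z = 0 → z.re = 0 ∧ riemannZeta (1 / 2 + z) = 0 := by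
    intro z hz h
    have hre : (1 / 2 + z).re = 1 / 2 + z.re := by simp
    have h1 : 1 / 2 + z ≠ 1 := by
      intro h1
      have : z = 1 / 2 := by linear_combination h1
      rw [this, centredXi_half] at h
      exact one_ne_zero h
    have h2 := centredXi_eq (1 / 2 + z) h1 (by rw [hre]; linarith)
    rw [add_sub_cancel_left, h] at h2
    have hΓ : Complex.Gamma ((1 / 2 + z) / 2 + 1) ≠ 0 := by
      refine Complex.Gamma_ne_zero_of_re_pos ?_
      rw [Complex.add_re, Complex.div_ofNat_re, hre, Complex.one_re]
      linarith
    have hπ : (Real.pi : ℂ) ^ (-(1 / 2 + z) / 2) ≠ 0 := by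
      simp [Complex.cpow_eq_zero_iff, Real.pi_ne_zero]
    have hζ : riemannZeta (1 / 2 + z) = 0 := by
      rcases mul_eq_zero.1 h2.symm with h3 | h3
      · exact absurd h3 (mul_ne_zero (mul_ne_zero (mul_ne_zero two_ne_zero (sub_ne_zero.2 h1)) hπ) hΓ)
      · exact h3
    have := re_eq_half_of_riemannZeta_eq_zero hRH hζ (by rw [hre]; linarith)
    rw [hre] at this
    exact ⟨by linarith, hζ⟩
  refine ⟨fun h => ?_, fun ⟨hz, h⟩ => ?_⟩
  · rcases le_total 0 z.re with hz | hz
    · exact key z hz h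
    · have h1 := (key (-z) (by simpa using hz) (by rwa [centredXi_neg])).1
      exact key z (by simpa using h1.le) h
  · have hre : (1 / 2 + z).re = 1 / 2 := by simp [hz]
    have h2 := centredXi_eq (1 / 2 + z) (fun h1 => by rw [h1] at hre; norm_num at hre)
      (by rw [hre]; norm_num)
    rw [add_sub_cancel_left, h, mul_zero] at h2
    exact h2

/-- Near the critical line the remaining factors form an analytic function `u` without zeros, and a
translation preserves orders. The strip `V` avoids the pole s = 1 and the poles of Γ(s/2 + 1). -/
theorem analyticOrderNatAt_centredXi {z : ℂ} (hz : z.re = 0) :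
    analyticOrderNatAt centredXi z = analyticOrderNatAt riemannZeta (1 / 2 + z) := by
  set u : ℂ → ℂ := fun w => 2 * ((1 / 2 + w) - 1) * (Real.pi : ℂ) ^ (-(1 / 2 + w) / 2) *
    Complex.Gamma ((1 / 2 + w) / 2 + 1) with hu
  set V : Set ℂ := {w : ℂ | -1 < w.re ∧ w.re < 1 / 2} with hV
  have hVo : IsOpen V := (isOpen_lt continuous_const Complex.continuous_re).inter
    (isOpen_lt Complex.continuous_re continuous_const)
  have hzV : V ∈ 𝓝 z := hVo.mem_nhds (by simp [hV, hz])
  have h1 : ∀ w ∈ V, (1 / 2 + w : ℂ) ≠ 1 := by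
    intro w hw h
    have := congrArg Complex.re h
    simp only [Complex.add_re, Complex.div_ofNat_re, Complex.one_re] at this
    linarith [hw.2]
  have hre : ∀ w ∈ V, 0 < ((1 / 2 + w) / 2 + 1 : ℂ).re := by
    intro w hw
    simp only [Complex.add_re, Complex.div_ofNat_re, Complex.one_re]
    linarith [hw.1]
  have hd : DifferentiableOn ℂ u V := by
    intro w hw
    have hΓ : DifferentiableAt ℂ (fun w : ℂ => Complex.Gamma ((1 / 2 + w) / 2 + 1)) w := by
      refine (Complex.differentiableAt_Gamma _ fun m hm => ?_).comp w (by fun_prop)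
      have := hre w hw
      rw [hm] at this
      simp only [Complex.neg_re, Complex.natCast_re] at this
      linarith [m.cast_nonneg (α := ℝ)]
    have hπ : DifferentiableAt ℂ (fun w : ℂ => (Real.pi : ℂ) ^ (-(1 / 2 + w) / 2)) w :=
      DifferentiableAt.const_cpow (by fun_prop) (Or.inl (by simp [Real.pi_ne_zero]))
    exact (((by fun_prop : DifferentiableAt ℂ (fun w : ℂ => 2 * ((1 / 2 + w) - 1)) w).mul
      hπ).mul hΓ).differentiableWithinAt
  have hua : AnalyticAt ℂ u z := hd.analyticAt hzV
  have hu0 : u z ≠ 0 := by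
    have hz' : z ∈ V := by simp [hV, hz]
    refine mul_ne_zero (mul_ne_zero (mul_ne_zero two_ne_zero (sub_ne_zero.2 (h1 z hz'))) ?_)
      (Complex.Gamma_ne_zero_of_re_pos (hre z hz'))
    simp [Complex.cpow_eq_zero_iff, Real.pi_ne_zero]
  have hζ : AnalyticAt ℂ riemannZeta (1 / 2 + z) :=
    analyticOn_riemannZeta _ (h1 z (mem_of_mem_nhds hzV))
  have hsh : AnalyticAt ℂ (fun w : ℂ => 1 / 2 + w) z := by fun_prop
  have hev : centredXi =ᶠ[𝓝 z] u * (riemannZeta ∘ fun w => 1 / 2 + w) := by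
    filter_upwards [hzV] with w hw
    have := centredXi_eq (1 / 2 + w) (h1 w hw) (by
      have := hre w hw
      simp only [Complex.add_re, Complex.div_ofNat_re, Complex.one_re] at this ⊢
      linarith)
    rwa [add_sub_cancel_left] at this
  have hder : deriv (fun w : ℂ => 1 / 2 + w) z ≠ 0 := by
    rw [deriv_const_add, deriv_id'']
    exact one_ne_zero
  rw [analyticOrderNatAt, analyticOrderNatAt, analyticOrderAt_congr hev,
    analyticOrderAt_mul hua (AnalyticAt.comp hζ hsh), hua.analyticOrderAt_eq_zero.2 hu0, zero_add,
    analyticOrderAt_comp_of_deriv_ne_zero hsh hder]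

theorem analyticOrderNatAt_centredXi_neg (z : ℂ) :
    analyticOrderNatAt centredXi (-z) = analyticOrderNatAt centredXi z := by
  have h : analyticOrderAt (centredXi ∘ Neg.neg) z = analyticOrderAt centredXi (-z) :=
    analyticOrderAt_comp_of_deriv_ne_zero (g := fun w : ℂ => -w) (by fun_prop) (by simp)
  have e : centredXi ∘ Neg.neg = centredXi := funext centredXi_neg
  rw [analyticOrderNatAt, ← h, e, analyticOrderNatAt]

/-- The zeros of `centredXi` attached to the zeros of `ζ` up to height `T`. -/
noncomputable def centredXiZeros (T : ℝ) : Finset ℂ :=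
  (nontrivialZerosUpTo_finite T).toFinset.image (fun ρ => ρ - 1 / 2) ∪
    (nontrivialZerosUpTo_finite T).toFinset.image (fun ρ => -(ρ - 1 / 2))

/-- Under RH the zeros are purely imaginary, so the disc |z| ≤ T cuts out exactly the ordinates up
to T and their negatives. A zero with Im z = 0 would have to be z = 0, which is excluded. -/
theorem mem_centredXiZeros (hRH : RiemannHypothesis) (T : ℝ) (z : ℂ) :
    z ∈ centredXiZeros T ↔ centredXi z = 0 ∧ ‖z‖ ≤ T := by
  have hnorm : ∀ z : ℂ, z.re = 0 → ‖z‖ = |z.im| := fun z hz => by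
    rw [Complex.norm_eq_sqrt_sq_add_sq, hz, zero_pow two_ne_zero, zero_add, Real.sqrt_sq_eq_abs]
  have key : ∀ z : ℂ, 0 < z.im → (z ∈ (nontrivialZerosUpTo_finite T).toFinset.image
      (fun ρ => ρ - 1 / 2) ↔ centredXi z = 0 ∧ ‖z‖ ≤ T) := by
    intro z hz
    rw [Finset.mem_image, centredXi_eq_zero_iff hRH]
    constructor
    · rintro ⟨ρ, hρ, rfl⟩
      rw [mem_nontrivialZeros_toFinset] at hρ
      have h1 := re_eq_half_of_riemannZeta_eq_zero hRH hρ.1 hρ.2.1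
      have h2 : (ρ - 1 / 2).re = 0 := by simp [h1]
      refine ⟨⟨h2, by simpa using hρ.1⟩, ?_⟩
      rw [hnorm _ h2, abs_of_pos hz]
      simpa using hρ.2.2.2.2
    · rintro ⟨⟨h1, h2⟩, h3⟩
      refine ⟨1 / 2 + z, ?_, by ring⟩
      rw [hnorm z h1, abs_of_pos hz] at h3
      rw [mem_nontrivialZeros_toFinset]
      refine ⟨h2, ?_, ?_, ?_, ?_⟩ <;> simp [h1, hz, h3]
      norm_num
  have him : ∀ z ∈ (nontrivialZerosUpTo_finite T).toFinset.image (fun ρ => ρ - 1 / 2),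
      0 < z.im := by
    intro z hz
    obtain ⟨ρ, hρ, rfl⟩ := Finset.mem_image.1 hz
    rw [mem_nontrivialZeros_toFinset] at hρ
    simpa using hρ.2.2.2.1
  have hneg : z ∈ (nontrivialZerosUpTo_finite T).toFinset.image (fun ρ => -(ρ - 1 / 2)) ↔
      -z ∈ (nontrivialZerosUpTo_finite T).toFinset.image (fun ρ => ρ - 1 / 2) := by
    simp only [Finset.mem_image]
    exact exists_congr fun ρ => and_congr_right fun _ => neg_eq_iff_eq_neg
  rw [centredXiZeros, Finset.mem_union, hneg]
  constructor
  · rintro (h | h)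
    · exact (key z (him z h)).1 h
    · have := (key (-z) (him _ h)).1 h
      rwa [centredXi_neg, norm_neg] at this
  · intro h
    rcases lt_trichotomy z.im 0 with hz | hz | hz
    · exact Or.inr ((key (-z) (by simpa using hz)).2 (by rwa [centredXi_neg, norm_neg]))
    · have h0 : z = 0 := Complex.ext ((centredXi_eq_zero_iff hRH z).1 h.1).1 hz
      exact absurd (h0 ▸ h.1) centredXi_zero_ne_zero
    · exact Or.inl ((key z hz).2 h)

theorem tendsto_zeroCount_atTop (hRH : RiemannHypothesis) : Tendsto zeroCount atTop atTop := by
  refine tendsto_atTop_atTop_of_monotone zeroCount_mono fun b => ?_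
  -- Zeros come in pairs ±z, so 2b zeros of `centredXi` are needed to guarantee b ordinates.
  obtain ⟨V, hV, hcard⟩ := infinite_centredXi_zeros.exists_subset_card_eq (2 * b)
  set T := ∑ z ∈ V, ‖z‖
  refine ⟨T, ?_⟩
  have hsub : V ⊆ centredXiZeros T := fun z hz => (mem_centredXiZeros hRH T z).2
    ⟨hV hz, Finset.single_le_sum (fun i _ => norm_nonneg i) hz⟩
  have h1 : (centredXiZeros T).card ≤ 2 * (nontrivialZerosUpTo_finite T).toFinset.card := by
    rw [two_mul]
    exact (Finset.card_union_le _ _).trans (add_le_add Finset.card_image_le Finset.card_image_le)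
  have h2 : (nontrivialZerosUpTo_finite T).toFinset.card ≤ zeroCount T := by
    rw [Finset.card_eq_sum_ones]
    refine Finset.sum_le_sum fun ρ hρ => Nat.one_le_iff_ne_zero.2 ?_
    rw [mem_nontrivialZeros_toFinset] at hρ
    have hre : (ρ - 1 / 2).re = 0 := by
      simp [re_eq_half_of_riemannZeta_eq_zero hRH hρ.1 hρ.2.1]
    have h3 := analyticOrderNatAt_centredXi hre
    rw [add_sub_cancel] at h3
    have h4 : centredXi (ρ - 1 / 2) = 0 :=
      (centredXi_eq_zero_iff hRH _).2 ⟨hre, by simpa using hρ.1⟩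
    rw [← h3, Ne, ← ENat.natCast_inj, Nat.cast_analyticOrderNatAt (analyticOrderAt_centredXi_ne_top _)]
    exact analyticOrderAt_ne_zero.2 ⟨differentiable_centredXi.analyticAt _, h4⟩
  have := Finset.card_le_card hsub
  omega

/-- The zeros ±iγ contribute equally to an even power sum, and (iγ)^(2m) = (-1)^m γ^(2m). -/
theorem sum_centredXiZeros (hRH : RiemannHypothesis) (T : ℝ) (m : ℕ) :
    ∑ w ∈ centredXiZeros T, (analyticOrderNatAt centredXi w : ℂ) / w ^ (2 * m) =
      2 * (-1) ^ m * ((∑ ρ ∈ (nontrivialZerosUpTo_finite T).toFinset,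
        (analyticOrderNatAt riemannZeta ρ : ℝ) * (1 / ρ.im ^ (2 * m)) : ℝ) : ℂ) := by
  have hdisj : Disjoint ((nontrivialZerosUpTo_finite T).toFinset.image (fun ρ => ρ - 1 / 2))
      ((nontrivialZerosUpTo_finite T).toFinset.image (fun ρ => -(ρ - 1 / 2))) := by
    rw [Finset.disjoint_left]
    intro z h1 h2
    obtain ⟨ρ, hρ, rfl⟩ := Finset.mem_image.1 h1
    obtain ⟨ρ', hρ', h⟩ := Finset.mem_image.1 h2
    rw [mem_nontrivialZeros_toFinset] at hρ hρ'
    have := congrArg Complex.im h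
    simp at this
    linarith [hρ.2.2.2.1, hρ'.2.2.2.1]
  rw [centredXiZeros, Finset.sum_union hdisj, Finset.sum_image (by simp),
    Finset.sum_image (by simp), ← Finset.sum_add_distrib, Complex.ofReal_sum, Finset.mul_sum]
  refine Finset.sum_congr rfl fun ρ hρ => ?_
  rw [mem_nontrivialZeros_toFinset] at hρ
  have h1 := re_eq_half_of_riemannZeta_eq_zero hRH hρ.1 hρ.2.1
  have hre : (ρ - 1 / 2).re = 0 := by simp [h1]
  have h3 := analyticOrderNatAt_centredXi hre
  rw [add_sub_cancel] at h3
  have h4 : ρ - 1 / 2 = ρ.im * Complex.I := by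
    apply Complex.ext <;> simp [h1]
  have h5 : (ρ - 1 / 2) ^ (2 * m) = (-1) ^ m * (ρ.im : ℂ) ^ (2 * m) := by
    rw [h4, mul_pow, pow_mul Complex.I, Complex.I_sq]
    ring
  rw [analyticOrderNatAt_centredXi_neg, h3, Even.neg_pow (even_two_mul m), h5]
  have h6 : ((-1 : ℂ) ^ m)⁻¹ = (-1) ^ m := by rw [← inv_pow]; norm_num
  push_cast
  simp only [div_eq_mul_inv, mul_inv, h6]
  ring

/-- The power sums over the zeros of `ζ` converge to Taylor coefficients of the logarithmic
derivative of `centredXi`. -/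
theorem tendsto_sum_nontrivialZeros (hRH : RiemannHypothesis) {m : ℕ} (hm : 1 ≤ m) :
    Tendsto (fun n : ℕ => ((2 * m - 1)! : ℂ) * (2 * (-1) ^ m *
      ((∑ ρ ∈ (nontrivialZerosUpTo_finite n).toFinset,
        (analyticOrderNatAt riemannZeta ρ : ℝ) * (1 / ρ.im ^ (2 * m)) : ℝ) : ℂ)))
      atTop (𝓝 (-iteratedDeriv (2 * m - 1) (logDeriv centredXi) 0)) := by
  obtain ⟨M, hM0, hM1, hM2, hM3⟩ := exists_centredXi_growth
  rw [tendsto_iff_norm_sub_tendsto_zero]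
  refine squeeze_zero' (Eventually.of_forall fun _ => norm_nonneg _) ?_
    (tendsto_cauchy_bound hM0 hM2 (j := 2 * m - 1) (by omega))
  filter_upwards [eventually_ge_atTop 1] with n hn
  have h := norm_iteratedDeriv_logDeriv_add_sum_le differentiable_centredXi centredXi_zero_ne_zero
    (R := n) (by exact_mod_cast hn) (hM1 n hn) (hM3 n hn) (mem_centredXiZeros hRH n) (2 * m - 1)
  rw [Nat.sub_add_cancel (by omega), sum_centredXiZeros hRH] at h
  rw [sub_neg_eq_add, add_comm, Nat.sub_add_cancel (by omega)]
  exact h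

/-! ### Derivatives of log|ζ| at 1/2 -/

theorem iteratedDeriv_re_comp_ofReal {f : ℂ → ℂ} {x : ℝ} (hf : AnalyticAt ℂ f x) (n : ℕ) :
    iteratedDeriv n (fun y : ℝ => (f y).re) x = (iteratedDeriv n f x).re := by
  induction n generalizing f with
  | zero => simp
  | succ n ih =>
    rw [iteratedDeriv_succ', iteratedDeriv_succ', ← ih hf.deriv]
    refine Filter.EventuallyEq.iteratedDeriv_eq n ?_
    have h := (Complex.continuous_ofReal.tendsto x).eventually hf.eventually_analyticAt
    filter_upwards [h] with y hy
    exact hy.differentiableAt.hasDerivAt.real_of_complex.deriv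

theorem hasDerivAt_log_norm_comp_ofReal {f : ℂ → ℂ} {x : ℝ} (hf : DifferentiableAt ℂ f x)
    (h0 : f x ≠ 0) :
    HasDerivAt (fun y : ℝ => Real.log ‖f y‖) (logDeriv f x).re x := by
  have h1 : HasDerivAt (fun y : ℝ => f y) (deriv f x) x := hf.hasDerivAt.comp_ofReal
  have h2 := (h1.norm_sq.log (by simpa using h0)).const_mul (1 / 2)
  -- Passing to the squared norm replaces the norm by a smooth function of its argument.
  have e : (fun y : ℝ => Real.log ‖f y‖) = fun y : ℝ => 1 / 2 * Real.log (‖f y‖ ^ 2) := by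
    funext y
    rw [Real.log_pow]
    push_cast
    ring
  rw [e]
  refine h2.congr_deriv ?_
  rw [logDeriv_apply, Complex.div_re, Complex.inner, ← Complex.normSq_eq_norm_sq]
  simp only [Complex.mul_re, Complex.conj_re, Complex.conj_im]
  ring

theorem riemannZeta_half_ne_zero : riemannZeta (1 / 2) ≠ 0 := by
  intro h
  have h1 := centredXi_eq (1 / 2) (by norm_num) (by norm_num)
  rw [h, mul_zero, sub_self] at h1
  exact centredXi_zero_ne_zero h1

theorem analyticAt_riemannZeta_half : AnalyticAt ℂ riemannZeta (1 / 2) :=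
  analyticOn_riemannZeta _ (by norm_num)

theorem ofReal_half : ((1 / 2 : ℝ) : ℂ) = 1 / 2 := by push_cast; rfl

theorem contDiffAt_logAbsZeta : ContDiffAt ℝ ∞ logAbsZeta (1 / 2) := by
  have h1 : ContDiffAt ℝ ∞ (fun x : ℝ => riemannZeta x) (1 / 2) := by
    have h := (ofReal_half ▸ analyticAt_riemannZeta_half).contDiffAt (n := ∞)
    exact (h.restrict_scalars ℝ).comp (1 / 2 : ℝ) Complex.ofRealCLM.contDiff.contDiffAt
  have h0 : riemannZeta ((1 / 2 : ℝ) : ℂ) ≠ 0 := by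
    rw [ofReal_half]
    exact riemannZeta_half_ne_zero
  exact (h1.norm ℝ h0).log (norm_ne_zero_iff.2 h0)

theorem iteratedDeriv_logAbsZeta (n : ℕ) :
    iteratedDeriv (n + 1) logAbsZeta (1 / 2) =
      (iteratedDeriv n (logDeriv riemannZeta) (1 / 2)).re := by
  have ha : AnalyticAt ℂ (logDeriv riemannZeta) ((1 / 2 : ℝ) : ℂ) := by
    rw [ofReal_half]
    exact analyticAt_riemannZeta_half.deriv.div analyticAt_riemannZeta_half
      riemannZeta_half_ne_zero
  rw [iteratedDeriv_succ', ← ofReal_half, ← iteratedDeriv_re_comp_ofReal ha]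
  refine Filter.EventuallyEq.iteratedDeriv_eq n ?_
  have h : ∀ᶠ s : ℂ in 𝓝 ((1 / 2 : ℝ) : ℂ), AnalyticAt ℂ riemannZeta s ∧ riemannZeta s ≠ 0 := by
    rw [ofReal_half]
    exact analyticAt_riemannZeta_half.eventually_analyticAt.and
      (analyticAt_riemannZeta_half.continuousAt.eventually_ne riemannZeta_half_ne_zero)
  filter_upwards [(Complex.continuous_ofReal.tendsto (1 / 2 : ℝ)).eventually h] with y hy
  exact (hasDerivAt_log_norm_comp_ofReal hy.1.differentiableAt hy.2).deriv

/-- The relation between the Taylor coefficients of the logarithmic derivatives of `centredXi` and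
of `ζ`. -/
theorem iteratedDeriv_logDeriv_centredXi {j : ℕ} (hj : 1 ≤ j) :
    iteratedDeriv j (logDeriv centredXi) 0 = -(j ! : ℂ) * 2 ^ (j + 1) +
      iteratedDeriv j (logDeriv fun z : ℂ => Complex.Gamma ((5 / 4 : ℝ) + z / 2)) 0 +
      iteratedDeriv j (logDeriv riemannZeta) (1 / 2) := by
  -- The 5/4 is the constant term of s/2 + 1 at s = 1/2 + z.
  set A : ℂ → ℂ := fun z => Complex.Gamma ((5 / 4 : ℝ) + z / 2) with hA
  set B : ℂ → ℂ := fun z => riemannZeta (z + 1 / 2) with hB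
  set c : ℂ := -Complex.log Real.pi / 2 with hc
  have hAre : ∀ᶠ z : ℂ in 𝓝 0, 0 < (((5 / 4 : ℝ) : ℂ) + z / 2).re := by
    have : ContinuousAt (fun z : ℂ => (((5 / 4 : ℝ) : ℂ) + z / 2).re) 0 := by fun_prop
    refine this.eventually_const_lt ?_
    simp only [zero_div, add_zero, Complex.ofReal_re]
    norm_num
  have hAan : AnalyticAt ℂ A 0 := by
    rw [Complex.analyticAt_iff_eventually_differentiableAt]
    filter_upwards [hAre] with z hz using differentiableAt_Gamma_comp hz
  have hA0 : ∀ᶠ z in 𝓝 (0 : ℂ), A z ≠ 0 := by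
    filter_upwards [hAre] with z hz using Complex.Gamma_ne_zero_of_re_pos hz
  have hBan : AnalyticAt ℂ B 0 := by
    have h : AnalyticAt ℂ (fun z : ℂ => z + 1 / 2) 0 := by fun_prop
    exact AnalyticAt.fun_comp (by simpa using analyticAt_riemannZeta_half) h
  have hB0 : ∀ᶠ z in 𝓝 (0 : ℂ), B z ≠ 0 :=
    hBan.continuousAt.eventually_ne (by simpa [hB] using riemannZeta_half_ne_zero)
  have hlin : ∀ᶠ z in 𝓝 (0 : ℂ), z - 1 / 2 ≠ 0 := by
    have : ContinuousAt (fun z : ℂ => z - 1 / 2) 0 := by fun_prop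
    exact this.eventually_ne (by norm_num)
  have hre : ∀ᶠ z : ℂ in 𝓝 0, -2 < (z + 1 / 2).re := by
    have : ContinuousAt (fun z : ℂ => (z + 1 / 2).re) 0 := by fun_prop
    exact this.eventually_const_lt (by norm_num)
  have hEd : ∀ z : ℂ, HasDerivAt (fun z => (Real.pi : ℂ) ^ (-(z + 1 / 2) / 2))
      ((Real.pi : ℂ) ^ (-(z + 1 / 2) / 2) * c) z := by
    intro z
    have h : HasDerivAt (fun z : ℂ => -(z + 1 / 2) / 2) (-1 / 2) z :=
      (((hasDerivAt_id z).add_const _).neg).div_const 2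
    refine (h.const_cpow (c := (Real.pi : ℂ)) (Or.inl (by simp [Real.pi_ne_zero]))).congr_deriv ?_
    rw [hc]
    ring
  have hE0 : ∀ z : ℂ, (Real.pi : ℂ) ^ (-(z + 1 / 2) / 2) ≠ 0 := by
    intro z
    simp [Complex.cpow_eq_zero_iff, Real.pi_ne_zero]
  have hprod : ∀ᶠ z in 𝓝 (0 : ℂ), centredXi z =
      2 * ((z - 1 / 2) * (Real.pi : ℂ) ^ (-(z + 1 / 2) / 2) * A z * B z) := by
    filter_upwards [hre, hlin] with z hz hz1
    have h1 := centredXi_eq (z + 1 / 2) (fun h => hz1 (by linear_combination h)) hz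
    rw [add_sub_cancel_right] at h1
    have e : (z + 1 / 2) / 2 + 1 = ((5 / 4 : ℝ) : ℂ) + z / 2 := by push_cast; ring
    rw [h1, e]
    simp only [hA, hB]
    ring
  -- The factor π^(-s/2) contributes only the constant `c`, which disappears under differentiation
  -- since j ≥ 1.
  have hev : logDeriv centredXi =ᶠ[𝓝 0] fun z =>
      (z - 1 / 2)⁻¹ + c + logDeriv A z + logDeriv B z := by
    filter_upwards [hprod.eventually_nhds, hA0, hB0, hlin, hAan.eventually_analyticAt,
      hBan.eventually_analyticAt] with z hz hAz hBz hlz hAd hBd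
    have hld : HasDerivAt (fun z : ℂ => z - 1 / 2) 1 z := (hasDerivAt_id z).sub_const _
    rw [(logDeriv_congr_nhds hz).self_of_nhds, logDeriv_const_mul z 2 two_ne_zero,
      logDeriv_mul (f := fun z => (z - 1 / 2) * (Real.pi : ℂ) ^ (-(z + 1 / 2) / 2) * A z) z
        (mul_ne_zero (mul_ne_zero hlz (hE0 z)) hAz) hBz
        ((hld.differentiableAt.mul (hEd z).differentiableAt).mul hAd.differentiableAt)
        hBd.differentiableAt,
      logDeriv_mul (f := fun z => (z - 1 / 2) * (Real.pi : ℂ) ^ (-(z + 1 / 2) / 2)) z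
        (mul_ne_zero hlz (hE0 z)) hAz (hld.differentiableAt.mul (hEd z).differentiableAt)
        hAd.differentiableAt,
      logDeriv_mul (f := fun z => z - 1 / 2) z hlz (hE0 z) hld.differentiableAt
        (hEd z).differentiableAt]
    congr 3
    · rw [logDeriv_apply, hld.deriv, one_div]
    · rw [logDeriv_apply, (hEd z).deriv, mul_div_cancel_left₀ _ (hE0 z)]
  have hcA : ContDiffAt ℂ j (logDeriv A) 0 :=
    (hAan.deriv.div hAan hA0.self_of_nhds).contDiffAt
  have hcB : ContDiffAt ℂ j (logDeriv B) 0 :=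
    (hBan.deriv.div hBan hB0.self_of_nhds).contDiffAt
  have hcl : ContDiffAt ℂ j (fun z : ℂ => (z - 1 / 2)⁻¹) 0 :=
    (contDiffAt_id.sub contDiffAt_const).inv (by norm_num)
  have hcc : ContDiffAt ℂ j (fun _ : ℂ => c) 0 := contDiffAt_const
  have hBshift : logDeriv B = fun z => logDeriv riemannZeta (z + 1 / 2) := by
    funext z
    rw [logDeriv_apply, logDeriv_apply, hB, deriv_comp_add_const]
  rw [hev.iteratedDeriv_eq, iteratedDeriv_fun_add ((hcl.add hcc).add hcA) hcB,
    iteratedDeriv_fun_add (hcl.add hcc) hcA, iteratedDeriv_fun_add hcl hcc,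
    iteratedDeriv_inv_sub_const, hBshift, iteratedDeriv_comp_add_const]
  have hc0 : iteratedDeriv j (fun _ : ℂ => c) 0 = 0 := by
    rw [iteratedDeriv_const, if_neg (by omega)]
  simp only [hc0, zero_add, add_zero, one_div, inv_pow, div_inv_eq_mul]

/-! ### Power sums of the ordinates and conclusion -/

theorem tendsto_sum_vorosZ (hRH : RiemannHypothesis) {m : ℕ} (hm : 1 ≤ m) :
    Tendsto (fun n : ℕ => ∑ ρ ∈ (nontrivialZerosUpTo_finite n).toFinset,
      (analyticOrderNatAt riemannZeta ρ : ℝ) * (1 / ρ.im ^ (2 * m))) atTop (𝓝 (vorosZ m)) := by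
  set Q : ℝ := ∑' k : ℕ, 1 / (1 / 2 + 2 * ((k : ℝ) + 1)) ^ (2 * m) with hQ
  set D : ℂ := iteratedDeriv (2 * m - 1) (logDeriv riemannZeta) (1 / 2) with hD
  have hf : ((2 * m - 1)! : ℝ) ≠ 0 := by positivity
  have hodd : Odd (2 * m - 1) := ⟨m - 1, by omega⟩
  -- With a = 5/4 the polygamma terms 2a + 2i equal 1/2 + 2(i + 1), the distances from 1/2 to the
  -- trivial zeros. The order 2m - 1 is odd, which fixes the sign.
  have hΓ : iteratedDeriv (2 * m - 1)
      (logDeriv fun z : ℂ => Complex.Gamma ((5 / 4 : ℝ) + z / 2)) 0 = (2 * m - 1)! * (Q : ℂ) := by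
    have h1 := tendsto_sum_polygamma (a := 5 / 4) (by norm_num) (j := 2 * m - 1) (by omega)
    have h2 := (summable_vorosZ_series m hm).hasSum.tendsto_sum_nat
    have h3 := ((Complex.continuous_ofReal.tendsto _).comp h2).const_mul (-((2 * m - 1)! : ℂ))
    have h4 := tendsto_nhds_unique h1 (h3.congr fun n => ?_)
    · rw [← neg_inj, h4]
      ring
    · rw [hodd.neg_one_pow, neg_one_mul, Nat.sub_add_cancel (by omega)]
      simp only [Function.comp_apply]
      push_cast
      congr 1
      refine Finset.sum_congr rfl fun i _ => ?_
      congr 2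
      ring
  have h1 := tendsto_sum_nontrivialZeros hRH hm
  rw [iteratedDeriv_logDeriv_centredXi (by omega), hΓ, Nat.sub_add_cancel (by omega)] at h1
  -- The multiplier (-1)^m / (2 (2m - 1)!) undoes the factorial, the sign of i^(2m) and the doubling
  -- by the pairs ±iγ.
  have h2 := (Complex.continuous_re.tendsto _).comp
    (h1.const_mul ((((-1) ^ m / 2 * ((2 * m - 1)! : ℝ)⁻¹ : ℝ)) : ℂ))
  have hsq : ((-1 : ℝ) ^ m) * (-1) ^ m = 1 := by rw [← mul_pow]; simp
  have hV : vorosZ m = (((((-1) ^ m / 2 * ((2 * m - 1)! : ℝ)⁻¹ : ℝ)) : ℂ) *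
      -(-((2 * m - 1)! : ℂ) * 2 ^ (2 * m) + (2 * m - 1)! * (Q : ℂ) + D)).re := by
    have e : -(-((2 * m - 1)! : ℂ) * 2 ^ (2 * m) + (2 * m - 1)! * (Q : ℂ) + D) =
        ((((2 * m - 1)! : ℝ) * 2 ^ (2 * m) - (2 * m - 1)! * Q : ℝ) : ℂ) - D := by
      push_cast
      ring
    have e2 : iteratedDeriv (2 * m) logAbsZeta (1 / 2) = D.re := by
      have h := iteratedDeriv_logAbsZeta (2 * m - 1)
      rwa [Nat.sub_add_cancel (by omega)] at h
    rw [e, Complex.re_ofReal_mul, Complex.sub_re, Complex.ofReal_re, vorosZ, e2, ← hQ]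
    field_simp
    ring
  rw [hV]
  refine h2.congr fun n => ?_
  set s : ℝ := ∑ ρ ∈ (nontrivialZerosUpTo_finite n).toFinset,
    (analyticOrderNatAt riemannZeta ρ : ℝ) * (1 / ρ.im ^ (2 * m))
  have e : ((((-1) ^ m / 2 * ((2 * m - 1)! : ℝ)⁻¹ : ℝ)) : ℂ) *
      (((2 * m - 1)! : ℂ) * (2 * (-1) ^ m * (s : ℂ))) = (s : ℂ) := by
    have h3 : (((2 * m - 1)! : ℝ)⁻¹ * (2 * m - 1)!) = 1 := inv_mul_cancel₀ hf
    have h4 : ((-1) ^ m / 2 * ((2 * m - 1)! : ℝ)⁻¹) * ((2 * m - 1)! * (2 * (-1) ^ m * s)) = s := by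
      linear_combination (((-1 : ℝ) ^ m * (-1) ^ m) * s) * h3 + s * hsq
    have h5 := congrArg Complex.ofReal h4
    push_cast at h5 ⊢
    exact h5
  simp only [Function.comp_apply]
  rw [e, Complex.ofReal_re]

theorem mainTheorem1 (hRH : RiemannHypothesis) :
    (∀ n : ℕ, 1 ≤ n → 0 < zeroOrdinate n ∧ zeroOrdinate n ≤ zeroOrdinate (n + 1)) ∧
    ContDiffAt ℝ ∞ logAbsZeta (1 / 2) ∧
    (∀ m : ℕ, 1 ≤ m → HasSum (fun k : ℕ => 1 / zeroOrdinate (k + 1) ^ (2 * m)) (vorosZ m)) ∧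
    (∀ n : ℕ, Tendsto
      (fun m : ℕ =>
        (vorosZ m - ∑ k ∈ Finset.Icc 1 n, 1 / zeroOrdinate k ^ (2 * m)) ^ (-(1 / (2 * (m : ℝ)))))
      atTop (𝓝 (zeroOrdinate (n + 1)))) := by
  have hub := tendsto_zeroCount_atTop hRH
  have hZ : ∀ m : ℕ, 1 ≤ m →
      HasSum (fun k : ℕ => 1 / zeroOrdinate (k + 1) ^ (2 * m)) (vorosZ m) := fun m hm =>
    hasSum_zeroOrdinate_of_tendsto hub (g := fun y => 1 / y ^ (2 * m))
      (fun y => one_div_nonneg.2 ((even_two_mul m).pow_nonneg y)) (tendsto_sum_vorosZ hRH hm)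
  exact ⟨fun n hn => ⟨zeroOrdinate_pos hub hn, zeroOrdinate_le_of_le hub hn n.le_succ⟩,
    contDiffAt_logAbsZeta, hZ, fun n => tendsto_tail_rpow n (zeroOrdinate_pos hub (by omega))
      (fun k => zeroOrdinate_le_of_le hub (by omega) (by omega)) hZ⟩
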